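/- \textbf{Setting.} Let $d,T\ge 1$ be integers, $\delta\in(0,1)$, $\lambda>0$, $\tau_0>0$, $L,B\ge 0$, and write $\|x\|_M=\sqrt{x^\top Mx}$. Let $(\mathcal F_t)_{t\ge 0}$ be a filtration on a probability space, $(\mathcal D_t)_{1\le t\le T}$ fixed subsets of $\mathbb R^d$ and $\theta^*\in\mathbb R^d$ with $\|\theta^*\|\le B$ and $|\langle\phi,\theta^*\rangle|\le LB$ for all $\phi\in\mathcal D_t$. In round $t$ a vector $\phi_t\in\mathcal D_t$ with $\|\phi_t\|\le L$ is played, and $y_t=\langle\phi_t,\theta^*\rangle+\varepsilon_t$ and $\nu_t\ge 0$ are observed, where $\phi_t,\nu_t$ are $\mathcal F_{t-1}$-measurable, $\varepsilon_t$ is $\mathcal F_t$-measurable and square integrable, $\mathbb E[\varepsilon_t\mid\mathcal F_{t-1}]=0$ and $\mathbb E[\varepsilon_t^2\mid\mathcal F_{t-1}]=\nu_t^2$. The regret is $\mathrm{Reg}(T)=\sum_{t=1}^T\big[\sup_{\phi\in\mathcal D_t}\langle\phi,\theta^*\rangle-\langle\phi_t,\theta^*\rangle\big]$. \textbf{Algorithm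 (AdaOFUL).} Put $\sigma_{\min}=1/\sqrt T$, $c_0=\frac{1}{6\sqrt{3\log(2T^2/\delta)}}$, $c_1=\frac{1}{42\log(2T^2/\delta)}$, $\kappa=d\log\!\big(1+\frac{TL^2}{d\lambda\sigma_{\min}^2}\big)$, $\beta_0=\sqrt\lambda B$ and, for $t\ge 1$, $$\beta_t=32\Big(\frac{\kappa}{\tau_0}+\sqrt{\kappa\log\tfrac{2t^2}{\delta}}+\tau_0\log\tfrac{2t^2}{\delta}\Big)+5\sqrt\lambda B .$$ Start with $H_0=\lambda I$, $\theta_0=0$. In round $t=1,\dots,T$ the pair $(\phi_t,\tilde\theta_t)$ maximizes $\langle\phi,\theta\rangle$ over $\phi\in\mathcal D_t$, $\theta\in\mathcal C_{t-1}=\{\theta:\|\theta\|\le B,\ \|\theta-\theta_{t-1}\|_{H_{t-1}}\le\beta_{t-1}\}$; then $$\sigma_t=\max\Big\{\nu_t,\ \sigma_{\min},\ \frac{\|\phi_t\|_{H_{t-1}^{-1}}}{c_0},\ \frac{\sqrt{LB}\,\|\phi_t\|_{H_{t-1}^{-1}}^{1/2}}{c_1^{1/4}d^{1/4}}\Big\},\quad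 w_t=\Big\|\frac{\phi_t}{\sigma_t}\Big\|_{H_{t-1}^{-1}},\quad \tau_t=\tau_0\frac{\sqrt{1+w_t^2}}{w_t},\quad H_t=H_{t-1}+\frac{\phi_t\phi_t^\top}{\sigma_t^2},$$ and $\theta_t$ minimizes $\frac\lambda2\|\theta\|^2+\sum_{s=1}^t\ell_{\tau_s}\!\big(\frac{y_s-\langle\phi_s,\theta\rangle}{\sigma_s}\big)$ over $\|\theta\|\le B$, where $\ell_\tau(x)=\tau(\sqrt{\tau^2+x^2}-\tau)$ (a summand with $\phi_s=0$ does not depend on $\theta$ and is omitted). \textbf{Theorem.} If $\tau_0\sqrt{\log(2T^2/\delta)}\ge\max\{\sqrt{2\kappa},\,2\sqrt d\,LB\}$, then with probability at least $1-3\delta$, $$\mathrm{Reg}(T)\le 2\beta_T\left[\sqrt{2\kappa}\,\sqrt{\sum_{t=1}^T\nu_t^2+1}+\frac{2L\kappa}{c_0^2\sqrt\lambda}+\frac{2LB\kappa}{\sqrt{c_1 d}}\right].$$ -/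

import Mathlib

open MeasureTheory ProbabilityTheory
open scoped Matrix RealInnerProductSpace

noncomputable section

/-- `ℝᵈ` with the Euclidean (`ℓ₂`) norm. -/
abbrev Vec (d : ℕ) : Type := EuclideanSpace ℝ (Fin d)

/-- The norm `‖x‖_M = √(xᵀ M x)` attached to a matrix `M`. -/
def matNorm {d : ℕ} (M : Matrix (Fin d) (Fin d) ℝ) (x : Vec d) : ℝ :=
  Real.sqrt (x.ofLp ⬝ᵥ (M *ᵥ x.ofLp))

/-- The pseudo-Huber loss `ℓ_τ(x) = τ (√(τ² + x²) - τ)`. -/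
def pseudoHuber (τ x : ℝ) : ℝ := τ * (Real.sqrt (τ ^ 2 + x ^ 2) - τ)

/-- The numerical inputs of AdaOFUL: dimension, horizon, confidence level, ridge parameter, the
bounds `L` (features) and `B` (unknown vector), the variance floor `σ_min` and the robustification
parameter `τ₀`. -/
structure AdaOFULParams where
  d : ℕ
  T : ℕ
  δ : ℝ
  lam : ℝ
  L : ℝ
  B : ℝ
  sigmaMin : ℝ
  τ₀ : ℝ

namespace AdaOFULParams

variable (P : AdaOFULParams)

/-- `c₀ = 1 / (6 √(3 log (2T²/δ)))`. -/
def c₀ : ℝ := 1 / (6 * Real.sqrt (3 * Real.log (2 * (P.T : ℝ) ^ 2 / P.δ)))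

/-- `c₁ = 1 / (42 log (2T²/δ))`. -/
def c₁ : ℝ := 1 / (42 * Real.log (2 * (P.T : ℝ) ^ 2 / P.δ))

/-- `κ = d log (1 + T L² / (d λ σ_min²))`. -/
def kappa : ℝ :=
  (P.d : ℝ) * Real.log (1 + (P.T : ℝ) * P.L ^ 2 / ((P.d : ℝ) * P.lam * P.sigmaMin ^ 2))

/-- The exploration radius `β_t`; the algorithm is initialised with `β_0 = √λ B`. -/
def beta : ℕ → ℝ
  | 0 => Real.sqrt P.lam * P.B
  | t + 1 =>
      32 * (P.kappa / P.τ₀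
          + Real.sqrt (P.kappa * Real.log (2 * ((t + 1 : ℕ) : ℝ) ^ 2 / P.δ))
          + P.τ₀ * Real.log (2 * ((t + 1 : ℕ) : ℝ) ^ 2 / P.δ))
        + 5 * Real.sqrt P.lam * P.B

/-- `σ_t` as a function of `H_{t-1}`, `φ_t`, `ν_t`. -/
def sigmaOf (H : Matrix (Fin P.d) (Fin P.d) ℝ) (φ : Vec P.d) (ν : ℝ) : ℝ :=
  max (max ν P.sigmaMin)
    (max (matNorm H⁻¹ φ / P.c₀)
      (Real.sqrt (P.L * P.B) * Real.sqrt (matNorm H⁻¹ φ)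
        / (P.c₁ ^ (1 / 4 : ℝ) * (P.d : ℝ) ^ (1 / 4 : ℝ))))

/-- The shape matrices along a path `(φ_t, ν_t)_{t ≥ 1}`: `H_0 = λ I` and
`H_t = H_{t-1} + σ_t⁻² φ_t φ_tᵀ`. -/
def shape (φ : ℕ → Vec P.d) (ν : ℕ → ℝ) : ℕ → Matrix (Fin P.d) (Fin P.d) ℝ
  | 0 => P.lam • (1 : Matrix (Fin P.d) (Fin P.d) ℝ)
  | t + 1 =>
      shape φ ν t +
        ((P.sigmaOf (shape φ ν t) (φ (t + 1)) (ν (t + 1))) ^ 2)⁻¹ •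
          Matrix.vecMulVec (φ (t + 1)).ofLp (φ (t + 1)).ofLp

/-- `σ_t`, meaningful for rounds `t ≥ 1`. -/
def sigma (φ : ℕ → Vec P.d) (ν : ℕ → ℝ) (t : ℕ) : ℝ :=
  P.sigmaOf (P.shape φ ν (t - 1)) (φ t) (ν t)

/-- `w_t = ‖φ_t / σ_t‖_{H_{t-1}⁻¹}`, meaningful for rounds `t ≥ 1`. -/
def weight (φ : ℕ → Vec P.d) (ν : ℕ → ℝ) (t : ℕ) : ℝ :=
  matNorm (P.shape φ ν (t - 1))⁻¹ ((P.sigma φ ν t)⁻¹ • φ t)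

/-- `τ_t = τ₀ √(1 + w_t²) / w_t`. When `w_t = 0`, that is `φ_t = 0`, the `t`-th summand of the
objective below does not depend on `θ`, so the value used for `τ_t` is irrelevant. -/
def tau (φ : ℕ → Vec P.d) (ν : ℕ → ℝ) (t : ℕ) : ℝ :=
  P.τ₀ * Real.sqrt (1 + P.weight φ ν t ^ 2) / P.weight φ ν t

/-- The objective
`L_t(θ) = (λ/2) ‖θ‖² + ∑_{s=1}^t ℓ_{τ_s} ((y_s - ⟨φ_s, θ⟩) / σ_s)`. -/
def objective (φ : ℕ → Vec P.d) (ν y : ℕ → ℝ) (t : ℕ) (θ : Vec P.d) : ℝ :=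
  P.lam / 2 * ‖θ‖ ^ 2 +
    ∑ s ∈ Finset.Icc 1 t,
      pseudoHuber (P.tau φ ν s) ((y s - ⟪φ s, θ⟫) / P.sigma φ ν s)

/-- The confidence set `C_t = {θ : ‖θ‖ ≤ B, ‖θ - θ_t‖_{H_t} ≤ β_t}`. -/
def confSet (φ : ℕ → Vec P.d) (ν : ℕ → ℝ) (θ : ℕ → Vec P.d) (t : ℕ) : Set (Vec P.d) :=
  {x | ‖x‖ ≤ P.B ∧ matNorm (P.shape φ ν t) (x - θ t) ≤ P.beta t}

/-- One execution of AdaOFUL over rounds `1, …, T` with decision sets `D_t`: played features `φ_t`,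
observed `(y_t, ν_t)` and estimators `θ_t`. -/
structure IsAdaOFULRun (D : ℕ → Set (Vec P.d)) (φ : ℕ → Vec P.d) (ν y : ℕ → ℝ)
    (θ : ℕ → Vec P.d) : Prop where
  /-- `θ_0 = 0`. -/
  init : θ 0 = 0
  /-- `(φ_{t+1}, ·)` maximises `⟨φ, θ⟩` over `φ ∈ D_{t+1}`, `θ ∈ C_t`. -/
  optimism : ∀ t < P.T, φ (t + 1) ∈ D (t + 1) ∧
    ∃ x ∈ P.confSet φ ν θ t,
      ∀ φ' ∈ D (t + 1), ∀ x' ∈ P.confSet φ ν θ t, ⟪φ', x'⟫ ≤ ⟪φ (t + 1), x⟫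
  /-- `θ_t` minimises the objective `L_t` over the ball of radius `B`. -/
  estimator : ∀ t, 1 ≤ t → t ≤ P.T →
    ‖θ t‖ ≤ P.B ∧ ∀ x : Vec P.d, ‖x‖ ≤ P.B →
      P.objective φ ν y t (θ t) ≤ P.objective φ ν y t x

end AdaOFULParams

/-- The heavy-tailed stochastic linear bandit with unknown vector `θs`, decision sets `D_t`,
played features `φ_t`, rewards `y_t = ⟨φ_t, θs⟩ + ε_t` and conditional variances `ν_t²`, over the
rounds `1, …, T`. -/
structure IsHeavyTailedBandit {Ω : Type*} [mΩ : MeasurableSpace Ω] (μ : Measure Ω)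
    (ℱ : Filtration ℕ mΩ) {d : ℕ} (T : ℕ) (L B : ℝ) (D : ℕ → Set (Vec d)) (θs : Vec d)
    (φ : ℕ → Ω → Vec d) (ν y ε : ℕ → Ω → ℝ) : Prop where
  norm_param : ‖θs‖ ≤ B
  /-- Mean rewards are bounded by `L B`; automatic when every vector of `D_t` has norm at most
  `L`. -/
  mean_bound : ∀ t < T, ∀ x ∈ D (t + 1), |⟪x, θs⟫| ≤ L * B
  mem : ∀ t < T, ∀ ω, φ (t + 1) ω ∈ D (t + 1)
  norm_feature : ∀ t < T, ∀ ω, ‖φ (t + 1) ω‖ ≤ L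
  reward : ∀ t < T, ∀ ω, y (t + 1) ω = ⟪φ (t + 1) ω, θs⟫ + ε (t + 1) ω
  feature_meas : ∀ t < T, StronglyMeasurable[ℱ t] (φ (t + 1))
  std_meas : ∀ t < T, StronglyMeasurable[ℱ t] (ν (t + 1))
  std_nonneg : ∀ t < T, ∀ ω, 0 ≤ ν (t + 1) ω
  noise_meas : ∀ t < T, StronglyMeasurable[ℱ (t + 1)] (ε (t + 1))
  noise_sq_integrable : ∀ t < T, MemLp (ε (t + 1)) 2 μ
  noise_mean : ∀ t < T, μ[ε (t + 1) | ℱ t] =ᵐ[μ] 0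
  noise_var : ∀ t < T,
    μ[fun ω => (ε (t + 1) ω) ^ 2 | ℱ t] =ᵐ[μ] fun ω => (ν (t + 1) ω) ^ 2

/-- `Reg(T) = ∑_{t=1}^T (sup_{x ∈ D_t} ⟨x, θs⟩ - ⟨φ_t, θs⟩)`. -/
def regret {d : ℕ} (T : ℕ) (D : ℕ → Set (Vec d)) (θs : Vec d) (φ : ℕ → Vec d) : ℝ :=
  ∑ t ∈ Finset.Icc 1 T, (sSup ((fun x : Vec d => ⟪x, θs⟫) '' D t) - ⟪φ t, θs⟫)

end

/-! ### Quadratic forms, dual norms and rank-one updates. -/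

section QuadraticForms

variable {d : ℕ} {M : Matrix (Fin d) (Fin d) ℝ}

/-! Write `X_t = φ_t / σ_t`, `z_t = ε_t / σ_t`, and let `p_t` be the norm of `X_t` for the inverse
of the updated matrix `H_t`. The choice of `τ_t` amounts to `1 / τ_t = p_t / τ₀` (`inv_tau_eq`), so
every robustness threshold is expressed by the leverage `p_t`, and `∑ p_t² ≤ κ` by the elliptical
potential argument.

Confidence sets. First-order optimality of `θ_t` towards `θs` and monotonicity of the loss
derivative give an energy inequality for the error (`estimation_error_le`). A round contributes full
curvature unless its noise exceeds half its threshold. Such outliers lose at most a multiple of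
`p_s²` times the squared error, so a total outlier leverage of at most 1/20 is harmless. Curvature
also needs small shifts of the residuals, which the fourth entry in the maximum defining `σ_t`
guarantees (`leverage_mul_shift_le`). What remains is the self-normalised sum of noise scores.

Concentration. Two nonnegative potentials start at 1 and have nonincreasing expectation: a
compensated `cosh` of the norm of the noise sum (`integral_noisePotential_succ_le`) and a
compensated exponential of the outlier leverage (`integral_outlierPotential_succ_le`). Both use only
`E z_t = 0` and `E z_t² ≤ 1`, conditionally on the past. The `cosh` handles the vector-valued sum
without a covering argument, via the second-order bound `cosh_le_of_sq_eq`. Markov's inequality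
costs `δ` once for the outliers and `δ / t²` at each round `t` for the noise, hence at most `3δ` in
all.

Regret. When `θs` lies in all confidence sets, optimism bounds the regret by `2 β_T ∑ w_t σ_t`.
Splitting by the entry attaining the maximum in `σ_t` yields the three terms of the bound
(`weight_mul_sigma_le`).

The shift estimate needs `d ≤ 2κ`, which holds if the ratio inside the logarithm of `κ` exceeds 1.
Otherwise the trivial bound `2LBT` suffices (`regret_le_of_ratio_le_one`). -/

lemma Matrix.IsHermitian.dotProduct_mulVec_comm (hM : M.IsHermitian) (x y : Fin d → ℝ) :
    x ⬝ᵥ (M *ᵥ y) = y ⬝ᵥ (M *ᵥ x) := by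
  have hT : Mᵀ = M := by simpa using hM.eq
  rw [Matrix.dotProduct_mulVec, ← Matrix.mulVec_transpose, hT, dotProduct_comm]

lemma Matrix.PosSemidef.quad_nonneg (hM : M.PosSemidef) (x : Fin d → ℝ) :
    0 ≤ x ⬝ᵥ (M *ᵥ x) := by
  simpa using hM.dotProduct_mulVec_nonneg x

lemma Matrix.PosSemidef.dotProduct_mulVec_sq_le (hM : M.PosSemidef) (x y : Fin d → ℝ) :
    (x ⬝ᵥ (M *ᵥ y)) ^ 2 ≤ (x ⬝ᵥ (M *ᵥ x)) * (y ⬝ᵥ (M *ᵥ y)) := by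
  have h := LinearMap.BilinForm.apply_mul_apply_le_of_forall_zero_le (Matrix.toBilin' M)
    (fun z => by simpa [Matrix.toBilin'_apply'] using hM.quad_nonneg z) x y
  simp only [Matrix.toBilin'_apply'] at h
  rwa [hM.isHermitian.dotProduct_mulVec_comm y x, ← sq] at h

lemma matNorm_nonneg (M : Matrix (Fin d) (Fin d) ℝ) (x : Vec d) : 0 ≤ matNorm M x :=
  Real.sqrt_nonneg _

lemma matNorm_sq (hM : M.PosSemidef) (x : Vec d) :
    matNorm M x ^ 2 = x.ofLp ⬝ᵥ (M *ᵥ x.ofLp) :=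
  Real.sq_sqrt (hM.quad_nonneg _)

lemma abs_dotProduct_mulVec_le (hM : M.PosSemidef) (x y : Vec d) :
    |x.ofLp ⬝ᵥ (M *ᵥ y.ofLp)| ≤ matNorm M x * matNorm M y := by
  refine abs_le_of_sq_le_sq ?_ (mul_nonneg (matNorm_nonneg _ _) (matNorm_nonneg _ _))
  rw [mul_pow, matNorm_sq hM, matNorm_sq hM]
  exact hM.dotProduct_mulVec_sq_le _ _

lemma matNorm_smul (M : Matrix (Fin d) (Fin d) ℝ) (c : ℝ) (x : Vec d) :
    matNorm M (c • x) = |c| * matNorm M x := by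
  unfold matNorm
  rw [← Real.sqrt_sq_eq_abs, ← Real.sqrt_mul (sq_nonneg c)]
  congr 1
  simp [Matrix.mulVec_smul]
  ring

lemma matNorm_neg (M : Matrix (Fin d) (Fin d) ℝ) (x : Vec d) : matNorm M (-x) = matNorm M x := by
  simpa using matNorm_smul M (-1) x

lemma quad_add (hM : M.PosSemidef) (x y : Vec d) :
    matNorm M (x + y) ^ 2 =
      matNorm M x ^ 2 + 2 * (x.ofLp ⬝ᵥ (M *ᵥ y.ofLp)) + matNorm M y ^ 2 := by
  rw [matNorm_sq hM, matNorm_sq hM, matNorm_sq hM]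
  simp only [WithLp.ofLp_add, Matrix.mulVec_add, add_dotProduct, dotProduct_add]
  rw [hM.isHermitian.dotProduct_mulVec_comm y.ofLp x.ofLp]
  ring

lemma matNorm_add_le (hM : M.PosSemidef) (x y : Vec d) :
    matNorm M (x + y) ≤ matNorm M x + matNorm M y := by
  refine abs_le_of_sq_le_sq' ?_ (add_nonneg (matNorm_nonneg _ _) (matNorm_nonneg _ _)) |>.2
  rw [quad_add hM]
  nlinarith [le_of_abs_le (abs_dotProduct_mulVec_le hM x y)]

lemma matNorm_sub_le (hM : M.PosSemidef) (x y : Vec d) :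
    matNorm M (x - y) ≤ matNorm M x + matNorm M y := by
  rw [sub_eq_add_neg, ← matNorm_neg M y]
  exact matNorm_add_le hM _ _

lemma matNorm_zero (M : Matrix (Fin d) (Fin d) ℝ) : matNorm M (0 : Vec d) = 0 := by
  simp [matNorm]

lemma real_inner_eq_dotProduct (x y : Vec d) : ⟪x, y⟫ = x.ofLp ⬝ᵥ y.ofLp := by
  rw [EuclideanSpace.inner_eq_star_dotProduct, dotProduct_comm]
  simp

lemma Matrix.PosDef.mulVec_inv_mulVec (hM : M.PosDef) (x : Fin d → ℝ) :
    M *ᵥ (M⁻¹ *ᵥ x) = x := by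
  rw [Matrix.mulVec_mulVec, Matrix.mul_nonsing_inv _ ((Matrix.isUnit_iff_isUnit_det _).1 hM.isUnit),
    Matrix.one_mulVec]

/-- Duality between `‖·‖_{M⁻¹}` and `‖·‖_M`. -/
lemma abs_inner_le_matNorm_inv_mul (hM : M.PosDef) (x y : Vec d) :
    |⟪x, y⟫| ≤ matNorm M⁻¹ x * matNorm M y := by
  have h1 : ⟪x, y⟫ = (WithLp.toLp 2 (M⁻¹ *ᵥ x.ofLp) : Vec d).ofLp ⬝ᵥ (M *ᵥ y.ofLp) := by
    rw [hM.isHermitian.dotProduct_mulVec_comm, hM.mulVec_inv_mulVec, real_inner_eq_dotProduct,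
      dotProduct_comm]
  have h2 : matNorm M (WithLp.toLp 2 (M⁻¹ *ᵥ x.ofLp)) = matNorm M⁻¹ x := by
    simp only [matNorm]
    rw [hM.mulVec_inv_mulVec, dotProduct_comm]
  rw [h1, ← h2]
  exact abs_dotProduct_mulVec_le hM.posSemidef _ _

/-- `‖·‖_{M⁻¹}` is antitone in `M`. -/
lemma matNorm_inv_le_of_le {N : Matrix (Fin d) (Fin d) ℝ} (hM : M.PosDef) (hN : N.PosDef)
    (hle : ∀ x, matNorm M x ≤ matNorm N x) (x : Vec d) :
    matNorm N⁻¹ x ≤ matNorm M⁻¹ x := by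
  -- This vector attains equality in the duality for `N`. Testing the duality for `M` on it and
  -- cancelling one factor gives the comparison.
  set v : Vec d := WithLp.toLp 2 (N⁻¹ *ᵥ x.ofLp)
  have h1 : matNorm N⁻¹ x ^ 2 = ⟪x, v⟫ := by
    rw [matNorm_sq hN.inv.posSemidef, real_inner_eq_dotProduct]
  have h2 : matNorm N v = matNorm N⁻¹ x := by
    simp only [matNorm, v]
    rw [hN.mulVec_inv_mulVec, dotProduct_comm]
  have h3 := le_of_abs_le (abs_inner_le_matNorm_inv_mul hM x v)
  rcases (matNorm_nonneg N⁻¹ x).eq_or_lt with h0 | h0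
  · rw [← h0]; exact matNorm_nonneg _ _
  · refine le_of_mul_le_mul_right ?_ h0
    calc matNorm N⁻¹ x * matNorm N⁻¹ x = ⟪x, v⟫ := by rw [← h1, sq]
      _ ≤ matNorm M⁻¹ x * matNorm M v := h3
      _ ≤ matNorm M⁻¹ x * matNorm N⁻¹ x := by
        rw [← h2]; exact mul_le_mul_of_nonneg_left (hle v) (matNorm_nonneg _ _)

lemma matNorm_add_vecMulVec_sq (hM : M.PosDef) (x v : Vec d) :
    matNorm (M + Matrix.vecMulVec x.ofLp x.ofLp) v ^ 2 = matNorm M v ^ 2 + ⟪x, v⟫ ^ 2 := by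
  have hps : (Matrix.vecMulVec x.ofLp x.ofLp).PosSemidef := by
    simpa using Matrix.posSemidef_vecMulVec_self_star x.ofLp
  rw [matNorm_sq hM.posSemidef, matNorm_sq (hM.add_posSemidef hps).posSemidef,
    Matrix.add_mulVec, dotProduct_add, Matrix.vecMulVec_mulVec, real_inner_eq_dotProduct]
  simp [dotProduct_comm v.ofLp x.ofLp]
  ring

lemma posDef_add_vecMulVec (hM : M.PosDef) (x : Vec d) :
    (M + Matrix.vecMulVec x.ofLp x.ofLp).PosDef :=
  hM.add_posSemidef (by simpa using Matrix.posSemidef_vecMulVec_self_star x.ofLp)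

/-- Sherman–Morrison on the diagonal: the leverage after a rank-one update. -/
lemma matNorm_inv_add_vecMulVec_self (hM : M.PosDef) (x : Vec d) :
    matNorm (M + Matrix.vecMulVec x.ofLp x.ofLp)⁻¹ x ^ 2 * (1 + matNorm M⁻¹ x ^ 2) =
      matNorm M⁻¹ x ^ 2 := by
  have hN := posDef_add_vecMulVec hM x
  set N := M + Matrix.vecMulVec x.ofLp x.ofLp with hNdef
  set u := M⁻¹ *ᵥ x.ofLp with hu
  -- The update maps `M⁻¹ x` to a multiple of `x`, so `N⁻¹ x` is parallel to `M⁻¹ x` and no formula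
  -- for `N⁻¹` is needed.
  have hNu : N *ᵥ u = (1 + x.ofLp ⬝ᵥ u) • x.ofLp := by
    rw [hNdef, Matrix.add_mulVec, Matrix.vecMulVec_mulVec, hM.mulVec_inv_mulVec]
    ext i
    simp
    ring
  have h1 : u = (1 + x.ofLp ⬝ᵥ u) • (N⁻¹ *ᵥ x.ofLp) := by
    rw [← Matrix.mulVec_smul, ← hNu, Matrix.mulVec_mulVec,
      Matrix.nonsing_inv_mul _ ((Matrix.isUnit_iff_isUnit_det _).1 hN.isUnit), Matrix.one_mulVec]
  rw [matNorm_sq hN.inv.posSemidef, matNorm_sq hM.inv.posSemidef, ← hu]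
  conv_rhs => rw [h1]
  simp
  ring

/-- The matrix determinant lemma. It makes `log det H_t` a running sum of `log (1 + w_s²)`. -/
lemma det_add_vecMulVec (hM : M.PosDef) (x : Vec d) :
    (M + Matrix.vecMulVec x.ofLp x.ofLp).det = M.det * (1 + matNorm M⁻¹ x ^ 2) := by
  rw [Matrix.vecMulVec_eq Unit, Matrix.det_add_replicateCol_mul_replicateRow
    ((Matrix.isUnit_iff_isUnit_det _).1 hM.isUnit), matNorm_sq hM.inv.posSemidef]
  congr 2
  simp [Matrix.det_unique, Matrix.mul_apply, Matrix.replicateRow, Matrix.replicateCol, dotProduct,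
    Matrix.mulVec, Finset.sum_mul, Finset.mul_sum]
  rw [Finset.sum_comm]
  simp [mul_assoc]

/-- The AM-GM inequality for determinants. -/
lemma Matrix.PosDef.log_det_le (hd : 0 < d) (hM : M.PosDef) :
    Real.log M.det ≤ d * Real.log (M.trace / d) := by
  have hd' : (0 : ℝ) < d := by exact_mod_cast hd
  have hpos := hM.eigenvalues_pos
  have hdet : M.det = ∏ i, hM.isHermitian.eigenvalues i := by
    simpa using hM.isHermitian.det_eq_prod_eigenvalues
  have htr : M.trace = ∑ i, hM.isHermitian.eigenvalues i := by
    simpa using hM.isHermitian.trace_eq_sum_eigenvalues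
  -- Jensen's inequality for `log` on the eigenvalues with uniform weights.
  have hcc := strictConcaveOn_log_Ioi.concaveOn.le_map_sum (t := Finset.univ)
    (w := fun _ : Fin d => (1 / d : ℝ)) (p := hM.isHermitian.eigenvalues)
    (fun i _ => by positivity) (by simp [hd'.ne']) (fun i _ => hpos i)
  simp only [smul_eq_mul, ← Finset.mul_sum] at hcc
  rw [hdet, htr, Real.log_prod (fun i _ => (hpos i).ne')]
  rw [div_mul_eq_mul_div, one_mul, div_mul_eq_mul_div, one_mul, div_le_iff₀ hd'] at hcc
  linarith

lemma matNorm_inv_le_norm_div {c : ℝ} (hc : 0 < c) (hM : M.PosDef)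
    (hle : ∀ x : Vec d, c * ‖x‖ ^ 2 ≤ matNorm M x ^ 2) (x : Vec d) :
    matNorm M⁻¹ x ≤ ‖x‖ / Real.sqrt c := by
  set v : Vec d := WithLp.toLp 2 (M⁻¹ *ᵥ x.ofLp)
  have h1 : matNorm M⁻¹ x ^ 2 = ⟪x, v⟫ := by
    rw [matNorm_sq hM.inv.posSemidef, real_inner_eq_dotProduct]
  have h2 : matNorm M v = matNorm M⁻¹ x := by
    simp only [matNorm, v]
    rw [hM.mulVec_inv_mulVec, dotProduct_comm]
  have h3 := real_inner_le_norm x v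
  have hs : 0 < Real.sqrt c := Real.sqrt_pos.2 hc
  have h4 : Real.sqrt c * ‖v‖ ≤ matNorm M⁻¹ x := by
    refine abs_le_of_sq_le_sq' ?_ (matNorm_nonneg _ _) |>.2
    rw [mul_pow, Real.sq_sqrt hc.le, ← h2]
    exact hle v
  rw [le_div_iff₀ hs]
  rcases (matNorm_nonneg M⁻¹ x).eq_or_lt with h0 | h0
  · rw [← h0]; simp
  · refine le_of_mul_le_mul_right ?_ h0
    calc matNorm M⁻¹ x * Real.sqrt c * matNorm M⁻¹ x
        = Real.sqrt c * matNorm M⁻¹ x ^ 2 := by ring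
      _ ≤ Real.sqrt c * (‖x‖ * ‖v‖) := by rw [h1]; gcongr
      _ = ‖x‖ * (Real.sqrt c * ‖v‖) := by ring
      _ ≤ ‖x‖ * matNorm M⁻¹ x := by gcongr

end QuadraticForms

/-! ### Second-order expansion of the hyperbolic cosine of a norm. -/

section HyperbolicBound

/-- `u ↦ cosh √u` is convex on `[0, ∞)`. -/
lemma cosh_convex_combination {r s t a b : ℝ} (ha : 0 ≤ a) (hb : 0 ≤ b) (hab : a + b = 1)
    (h : t ^ 2 = a * r ^ 2 + b * s ^ 2) :
    Real.cosh t ≤ a * Real.cosh r + b * Real.cosh s := by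
  -- As a power series in the square of the argument, `cosh` has nonnegative coefficients, and each
  -- power is convex on `[0, ∞)`.
  refine hasSum_le (fun n => ?_) (Real.hasSum_cosh t)
    (((Real.hasSum_cosh r).mul_left a).add ((Real.hasSum_cosh s).mul_left b))
  have hconv := (convexOn_pow (𝕜 := ℝ) n).2 (show r ^ 2 ∈ Set.Ici (0 : ℝ) from sq_nonneg r)
    (show s ^ 2 ∈ Set.Ici (0 : ℝ) from sq_nonneg s) ha hb hab
  simp only [smul_eq_mul] at hconv
  rw [← h] at hconv
  simp only [pow_mul]
  rw [← mul_div_assoc, ← mul_div_assoc, ← add_div]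
  gcongr

/-- Second-order bound on `cosh ‖x + y‖` for vectors with `‖x‖ = r`, `‖y‖ = s`, `⟨x, y⟩ = c`. -/
lemma cosh_le_of_sq_eq {r s c t : ℝ} (hr : 0 ≤ r) (hs : 0 ≤ s) (hc : |c| ≤ r * s)
    (h : t ^ 2 = r ^ 2 + 2 * c + s ^ 2) :
    Real.cosh t ≤ Real.cosh r + Real.sinh r / r * c + Real.cosh r * (Real.exp s - 1 - s) := by
  have hsinh : s ≤ Real.sinh s := Real.self_le_sinh_iff.2 hs
  have hexp : Real.exp s = Real.cosh s + Real.sinh s := (Real.cosh_add_sinh s).symm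
  rcases (mul_nonneg hr hs).eq_or_lt with h0 | h0
  -- If `r` or `s` vanishes so does `c`, and the conventional value of `sinh r / r` at `r = 0` plays
  -- no role.
  · have hc0 : c = 0 := abs_nonpos_iff.1 (h0 ▸ hc)
    subst hc0
    rcases mul_eq_zero.1 h0.symm with rfl | rfl
    · have : Real.cosh t = Real.cosh s := by
        rw [← Real.cosh_abs t, ← Real.cosh_abs s,
          (sq_eq_sq_iff_abs_eq_abs t s).1 (by rw [h]; ring)]
      rw [this, hexp]
      simp
      linarith
    · have : Real.cosh t = Real.cosh r := by
        rw [← Real.cosh_abs t, ← Real.cosh_abs r,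
          (sq_eq_sq_iff_abs_eq_abs t r).1 (by rw [h]; ring)]
      simp [this]
  · have hr0 : 0 < r := pos_of_mul_pos_left h0 hs
    have hs0 : 0 < s := pos_of_mul_pos_right h0 hr
    obtain ⟨hc1, hc2⟩ := abs_le.1 hc
    -- For fixed lengths, `t²` is affine in `c` between the antiparallel value `(r - s)²` and the
    -- parallel value `(r + s)²`, so `cosh t` is at most the corresponding mixture of the two
    -- extremes.
    have hmix := cosh_convex_combination (r := r + s) (s := r - s) (t := t)
      (a := (r * s + c) / (2 * (r * s))) (b := (r * s - c) / (2 * (r * s)))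
      (div_nonneg (by linarith) (by linarith)) (div_nonneg (by linarith) (by linarith))
      (by field_simp; ring) (by rw [h]; field_simp; ring)
    rw [Real.cosh_add, Real.cosh_sub] at hmix
    have e1 : (r * s + c) / (2 * (r * s)) *
          (Real.cosh r * Real.cosh s + Real.sinh r * Real.sinh s) +
        (r * s - c) / (2 * (r * s)) * (Real.cosh r * Real.cosh s - Real.sinh r * Real.sinh s) =
        Real.cosh r * Real.cosh s + c / (r * s) * (Real.sinh r * Real.sinh s) := by
      field_simp
      ring
    rw [e1] at hmix
    have hq : c / (r * s) ≤ 1 := (div_le_one h0).2 hc2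
    have e2 : Real.sinh r / r * c = c / (r * s) * (Real.sinh r * s) := by
      field_simp
    rw [e2, hexp]
    -- Only the part beyond first order in `s` is estimated crudely; the term linear in `c` is kept
    -- exactly because it must average to zero later.
    have h1 : c / (r * s) * (Real.sinh r * (Real.sinh s - s)) ≤
        1 * (Real.cosh r * (Real.sinh s - s)) := by
      have hsr : 0 ≤ Real.sinh r := Real.sinh_nonneg_iff.2 hr
      have hle : Real.sinh r ≤ Real.cosh r := (Real.sinh_lt_cosh r).le
      have hd : 0 ≤ Real.sinh s - s := by linarith
      calc c / (r * s) * (Real.sinh r * (Real.sinh s - s))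
          ≤ 1 * (Real.sinh r * (Real.sinh s - s)) :=
            mul_le_mul_of_nonneg_right hq (mul_nonneg hsr hd)
        _ ≤ _ := by rw [one_mul, one_mul]; exact mul_le_mul_of_nonneg_right hle hd
    linarith

lemma abs_sinh_div_mul_le {r m q : ℝ} (hr : 0 ≤ r) (hq : 0 ≤ q) (hm : |m| ≤ r * q) :
    |Real.sinh r / r * m| ≤ Real.cosh r * q := by
  have hs : 0 ≤ Real.sinh r := Real.sinh_nonneg_iff.2 hr
  have hle : Real.sinh r ≤ Real.cosh r := (Real.sinh_lt_cosh r).le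
  rw [abs_mul, abs_of_nonneg (div_nonneg hs hr)]
  rcases hr.eq_or_lt with rfl | h0
  · simpa using hq
  · calc Real.sinh r / r * |m| ≤ Real.sinh r / r * (r * q) := by gcongr
      _ = Real.sinh r * q := by field_simp
      _ ≤ _ := by gcongr

lemma exp_sub_one_sub_id_le_sq {s : ℝ} (h0 : 0 ≤ s) (h1 : s ≤ 1) : Real.exp s - 1 - s ≤ s ^ 2 :=
  (le_abs_self _).trans (Real.abs_exp_sub_one_sub_id_le (by rwa [abs_of_nonneg h0]))

lemma exp_le_one_add_two_mul {s : ℝ} (h0 : 0 ≤ s) (h1 : s ≤ 1) : Real.exp s ≤ 1 + 2 * s := by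
  nlinarith [exp_sub_one_sub_id_le_sq h0 h1]

end HyperbolicBound

/-! ### The score of the pseudo-Huber loss. -/

/-- The derivative `x / √(1 + (k x)²)` of the pseudo-Huber loss with threshold `1 / k`. -/
noncomputable def huberScore (k x : ℝ) : ℝ := x / Real.sqrt (1 + (k * x) ^ 2)

section HuberScore

lemma one_le_sqrt_one_add_sq (a : ℝ) : 1 ≤ Real.sqrt (1 + a ^ 2) :=
  Real.one_le_sqrt.2 (by nlinarith [sq_nonneg a])

lemma abs_huberScore_le (k x : ℝ) : |huberScore k x| ≤ |x| := by
  have h := one_le_sqrt_one_add_sq (k * x)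
  rw [huberScore, abs_div, abs_of_nonneg (Real.sqrt_nonneg _)]
  exact div_le_self (abs_nonneg _) h

lemma mul_abs_huberScore_le_one (k x : ℝ) : k * |huberScore k x| ≤ 1 := by
  have h := one_le_sqrt_one_add_sq (k * x)
  rw [huberScore, abs_div, abs_of_nonneg (Real.sqrt_nonneg _), ← mul_div_assoc,
    div_le_one (by linarith)]
  refine Real.le_sqrt_of_sq_le ?_
  rw [mul_pow, sq_abs, mul_pow]
  linarith

/-- The bias of the score is quadratic in the noise. It can therefore be charged to the variance,
and no symmetry of the noise is required. -/
lemma abs_huberScore_sub_le {k : ℝ} (hk : 0 ≤ k) (x : ℝ) :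
    |huberScore k x - x| ≤ k * x ^ 2 / 2 := by
  have h1 := one_le_sqrt_one_add_sq (k * x)
  set A := Real.sqrt (1 + (k * x) ^ 2) with hA
  have hA2 : A ^ 2 = 1 + (k * x) ^ 2 := Real.sq_sqrt (by positivity)
  have hA0 : 0 < A := by linarith
  have e : huberScore k x - x = -(x * (1 - 1 / A)) := by
    rw [huberScore, ← hA]; field_simp; ring
  have hn : 0 ≤ 1 - 1 / A := by rw [sub_nonneg, div_le_one hA0]; exact h1
  rw [e, abs_neg, abs_mul, abs_of_nonneg hn]
  have key : 1 - 1 / A ≤ k * |x| / 2 := by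
    have hkx : 0 ≤ k * |x| := by positivity
    have hsq : (k * |x|) ^ 2 = A ^ 2 - 1 := by rw [hA2, mul_pow, sq_abs]; ring
    rw [one_sub_div hA0.ne', div_le_iff₀ hA0]
    set v := k * |x|
    have : (A - 1) * (A + 1) = v ^ 2 := by rw [hsq]; ring
    nlinarith [sq_nonneg (v - 1), sq_nonneg (A - 1)]
  calc |x| * (1 - 1 / A) ≤ |x| * (k * |x| / 2) := by gcongr
    _ = k * x ^ 2 / 2 := by rw [← sq_abs x]; ring

lemma hasDerivAt_huberScore (k x : ℝ) :
    HasDerivAt (huberScore k) (1 / Real.sqrt (1 + (k * x) ^ 2) ^ 3) x := by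
  have h1 := one_le_sqrt_one_add_sq (k * x)
  have hpos : 0 < 1 + (k * x) ^ 2 := by positivity
  have hsq := Real.sq_sqrt hpos.le
  have hin : HasDerivAt (fun y : ℝ => 1 + (k * y) ^ 2) (2 * (k * x) * k) x := by
    have := (((hasDerivAt_id x).const_mul k).pow 2).const_add 1
    simpa using this
  have h := (hasDerivAt_id x).div (hin.sqrt hpos.ne') (by linarith)
  refine h.congr_deriv ?_
  simp only [id]
  set A := Real.sqrt (1 + (k * x) ^ 2)
  have hA0 : 0 < A := by linarith
  field_simp
  rw [hsq]
  ring

lemma huberScore_monotone (k : ℝ) : Monotone (huberScore k) :=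
  monotone_of_deriv_nonneg (fun x => (hasDerivAt_huberScore k x).differentiableAt) fun x => by
    rw [(hasDerivAt_huberScore k x).deriv]
    positivity

lemma huberScore_sub_mul_nonneg (k x y : ℝ) :
    0 ≤ (huberScore k x - huberScore k y) * (x - y) := by
  rcases le_total x y with h | h
  · exact mul_nonneg_of_nonpos_of_nonpos (sub_nonpos.2 (huberScore_monotone k h)) (by linarith)
  · exact mul_nonneg (sub_nonneg.2 (huberScore_monotone k h)) (by linarith)

lemma huberScore_sub_mul_ge_of_le {k x y : ℝ} (hk : 0 ≤ k) (hx : k * |x| ≤ 1) (hy : k * |y| ≤ 1)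
    (hxy : x ≤ y) : 7 / 20 * (y - x) ≤ huberScore k y - huberScore k x := by
  refine (convex_Icc x y).mul_sub_le_image_sub_of_le_deriv
    (fun z _ => (hasDerivAt_huberScore k z).continuousAt.continuousWithinAt)
    (fun z _ => (hasDerivAt_huberScore k z).differentiableAt.differentiableWithinAt)
    (fun z hz => ?_) x (Set.left_mem_Icc.2 hxy) y (Set.right_mem_Icc.2 hxy) hxy
  have hz' := interior_subset hz
  have h1 := one_le_sqrt_one_add_sq (k * z)
  have hkz : (k * z) ^ 2 ≤ 1 := by
    rw [sq_le_one_iff_abs_le_one, abs_mul, abs_of_nonneg hk]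
    refine (mul_le_mul_of_nonneg_left (abs_le_max_abs_abs hz'.1 hz'.2) hk).trans ?_
    rcases max_choice |x| |y| with h | h <;> rw [h] <;> assumption
  rw [(hasDerivAt_huberScore k z).deriv]
  have hsq : Real.sqrt (1 + (k * z) ^ 2) ^ 2 = 1 + (k * z) ^ 2 := Real.sq_sqrt (by positivity)
  set A := Real.sqrt (1 + (k * z) ^ 2)
  -- Here `A ≤ √2 < 17/12`, and the slope is `1 / A³ ≥ (12/17)³ > 7/20`.
  have hA : A ≤ 17 / 12 := by nlinarith
  rw [le_div_iff₀ (by positivity)]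
  nlinarith [pow_le_pow_left₀ (by linarith) hA 3]

lemma huberScore_sub_mul_ge {k x y : ℝ} (hk : 0 ≤ k) (hx : k * |x| ≤ 1) (hy : k * |y| ≤ 1) :
    7 / 20 * (x - y) ^ 2 ≤ (huberScore k x - huberScore k y) * (x - y) := by
  rcases le_total x y with h | h
  · nlinarith [huberScore_sub_mul_ge_of_le hk hx hy h]
  · nlinarith [huberScore_sub_mul_ge_of_le hk hy hx h]

/-- Strong monotonicity of the score at a small shift, outside the rounds with large noise. -/
lemma huberScore_shift_ge {k z u : ℝ} (hk : 0 ≤ k) (hu : k * |u| ≤ 1 / 2) :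
    7 / 20 * u ^ 2 * (1 - if 1 / 2 < k * |z| then 1 else 0) ≤
      (huberScore k z - huberScore k (z - u)) * u := by
  split_ifs with h
  · simpa using huberScore_sub_mul_nonneg k z (z - u)
  · have h1 : k * |z - u| ≤ 1 := by
      have := mul_le_mul_of_nonneg_left (abs_sub z u) hk
      linarith
    simpa using huberScore_sub_mul_ge hk (x := z) (by linarith) h1

lemma hasDerivAt_pseudoHuber {τ : ℝ} (hτ : 0 < τ) (x : ℝ) :
    HasDerivAt (pseudoHuber τ) (huberScore τ⁻¹ x) x := by
  have hpos : 0 < τ ^ 2 + x ^ 2 := by positivity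
  have hin : HasDerivAt (fun y : ℝ => τ ^ 2 + y ^ 2) (2 * x) x := by
    simpa using ((hasDerivAt_id x).pow 2).const_add (τ ^ 2)
  refine (((hin.sqrt hpos.ne').sub_const τ).const_mul τ).congr_deriv ?_
  have e : Real.sqrt (1 + (τ⁻¹ * x) ^ 2) = Real.sqrt (τ ^ 2 + x ^ 2) / τ := by
    rw [eq_div_iff hτ.ne', ← Real.sqrt_sq hτ.le, ← Real.sqrt_mul (by positivity),
      Real.sqrt_sq hτ.le]
    congr 1
    field_simp
  have hs : 0 < Real.sqrt (τ ^ 2 + x ^ 2) := Real.sqrt_pos.2 hpos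
  rw [huberScore, e]
  field_simp

end HuberScore

/-! ### Reindexing and a one-sided derivative test. -/

lemma sum_Icc_one_eq_sum_range {α : Type*} [AddCommMonoid α] (f : ℕ → α) (t : ℕ) :
    ∑ s ∈ Finset.Icc 1 t, f s = ∑ s ∈ Finset.range t, f (s + 1) := by
  induction t with
  | zero => simp
  | succ t ih => rw [Finset.sum_Icc_succ_top (by omega), ih, Finset.sum_range_succ]

lemma nonneg_of_hasDerivAt_of_forall_le {g : ℝ → ℝ} {g' : ℝ} (hg : HasDerivAt g g' 0)
    (hmin : ∀ h ∈ Set.Icc (0 : ℝ) 1, g 0 ≤ g h) : 0 ≤ g' := by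
  refine ge_of_tendsto hg.tendsto_slope_zero_right ?_
  filter_upwards [Ioo_mem_nhdsGT (show (0 : ℝ) < 1 by norm_num)] with h hh
  have := hmin h ⟨hh.1.le, hh.2.le⟩
  simp only [zero_add, smul_eq_mul]
  exact mul_nonneg (inv_nonneg.2 hh.1.le) (sub_nonneg.2 this)

/-! ### Weights, leverages and the elliptical potential. -/

namespace AdaOFULParams

variable (P : AdaOFULParams) (φ : ℕ → Vec P.d) (ν : ℕ → ℝ)

/-- The normalised feature `φ_t / σ_t`. -/
noncomputable def scaled (t : ℕ) : Vec P.d := (P.sigma φ ν t)⁻¹ • φ t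

/-- The leverage `‖φ_t / σ_t‖_{H_t⁻¹}` of round `t` with respect to the updated shape matrix. -/
noncomputable def leverage (t : ℕ) : ℝ := matNorm (P.shape φ ν t)⁻¹ (P.scaled φ ν t)

/-- The score of the noise of round `t`. -/
noncomputable def noiseScore (ε : ℕ → ℝ) (t : ℕ) : ℝ :=
  huberScore (P.leverage φ ν t / P.τ₀) (ε t / P.sigma φ ν t)

/-- The stochastic part of the gradient of the objective at the true parameter. -/
noncomputable def noiseSum (ε : ℕ → ℝ) (t : ℕ) : Vec P.d :=
  ∑ s ∈ Finset.range t, P.noiseScore φ ν ε (s + 1) • P.scaled φ ν (s + 1)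

/-- Indicator of the rounds whose noise exceeds half of the robustification threshold. -/
noncomputable def largeNoise (ε : ℕ → ℝ) (t : ℕ) : ℝ :=
  if 1 / 2 < P.leverage φ ν t / P.τ₀ * |ε t / P.sigma φ ν t| then 1 else 0

variable {P φ ν}

lemma sigmaMin_le_sigma (t : ℕ) : P.sigmaMin ≤ P.sigma φ ν t :=
  (le_max_right _ _).trans (le_max_left _ _)

lemma std_le_sigma (t : ℕ) : ν t ≤ P.sigma φ ν t :=
  (le_max_left _ _).trans (le_max_left _ _)

lemma shape_succ (t : ℕ) :
    P.shape φ ν (t + 1) = P.shape φ ν t +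
      Matrix.vecMulVec (P.scaled φ ν (t + 1)).ofLp (P.scaled φ ν (t + 1)).ofLp := by
  rw [shape, scaled, sigma, Nat.add_sub_cancel]
  congr 1
  rw [WithLp.ofLp_smul, Matrix.smul_vecMulVec, Matrix.vecMulVec_smul, smul_smul, ← mul_inv, ← sq]

lemma weight_succ (t : ℕ) :
    P.weight φ ν (t + 1) = matNorm (P.shape φ ν t)⁻¹ (P.scaled φ ν (t + 1)) := rfl

lemma shape_posDef (hlam : 0 < P.lam) (t : ℕ) : (P.shape φ ν t).PosDef := by
  induction t with
  | zero => exact Matrix.PosDef.one.smul hlam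
  | succ t ih => rw [shape_succ]; exact posDef_add_vecMulVec ih _

lemma matNorm_shape_sq (hlam : 0 < P.lam) (t : ℕ) (x : Vec P.d) :
    matNorm (P.shape φ ν t) x ^ 2 =
      P.lam * ‖x‖ ^ 2 + ∑ s ∈ Finset.range t, ⟪P.scaled φ ν (s + 1), x⟫ ^ 2 := by
  induction t with
  | zero =>
    rw [matNorm_sq (shape_posDef hlam 0).posSemidef, shape, Matrix.smul_mulVec, Matrix.one_mulVec,
      dotProduct_smul, ← real_inner_eq_dotProduct, real_inner_self_eq_norm_sq]
    simp
  | succ t ih =>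
    rw [shape_succ, matNorm_add_vecMulVec_sq (shape_posDef hlam t), ih, Finset.sum_range_succ]
    ring

lemma matNorm_shape_mono (hlam : 0 < P.lam) {s t : ℕ} (h : s ≤ t) (x : Vec P.d) :
    matNorm (P.shape φ ν s) x ≤ matNorm (P.shape φ ν t) x := by
  refine abs_le_of_sq_le_sq' ?_ (matNorm_nonneg _ _) |>.2
  rw [matNorm_shape_sq hlam, matNorm_shape_sq hlam]
  gcongr

lemma matNorm_inv_shape_succ_le (hlam : 0 < P.lam) (t : ℕ) (x : Vec P.d) :
    matNorm (P.shape φ ν (t + 1))⁻¹ x ≤ matNorm (P.shape φ ν t)⁻¹ x :=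
  matNorm_inv_le_of_le (shape_posDef hlam t) (shape_posDef hlam (t + 1))
    (matNorm_shape_mono hlam t.le_succ) x

lemma matNorm_inv_shape_le (hlam : 0 < P.lam) (t : ℕ) (x : Vec P.d) :
    matNorm (P.shape φ ν t)⁻¹ x ≤ ‖x‖ / Real.sqrt P.lam :=
  matNorm_inv_le_norm_div hlam (shape_posDef hlam t) (fun y => by
    rw [matNorm_shape_sq hlam]
    exact le_add_of_nonneg_right (Finset.sum_nonneg fun _ _ => sq_nonneg _)) x

lemma weight_nonneg (t : ℕ) : 0 ≤ P.weight φ ν t := matNorm_nonneg _ _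

lemma leverage_nonneg (t : ℕ) : 0 ≤ P.leverage φ ν t := matNorm_nonneg _ _

lemma leverage_sq_mul (hlam : 0 < P.lam) (t : ℕ) :
    P.leverage φ ν (t + 1) ^ 2 * (1 + P.weight φ ν (t + 1) ^ 2) = P.weight φ ν (t + 1) ^ 2 := by
  rw [leverage, weight_succ, shape_succ]
  exact matNorm_inv_add_vecMulVec_self (shape_posDef hlam t) _

lemma leverage_sq_eq (hlam : 0 < P.lam) (t : ℕ) :
    P.leverage φ ν (t + 1) ^ 2 = 1 - (1 + P.weight φ ν (t + 1) ^ 2)⁻¹ := by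
  have h := leverage_sq_mul (φ := φ) (ν := ν) hlam t
  have : 0 < 1 + P.weight φ ν (t + 1) ^ 2 := by positivity
  field_simp
  linarith

lemma leverage_le_weight (hlam : 0 < P.lam) (t : ℕ) :
    P.leverage φ ν (t + 1) ≤ P.weight φ ν (t + 1) :=
  matNorm_inv_shape_succ_le hlam t _

/-- This is what `τ_t` is designed for: the factor `√(1 + w_t²)` is exactly what Sherman–Morrison
needs to replace the norm for the old matrix by that for the updated one. When `w_t = 0` both sides
are zero by the convention for division. -/
lemma inv_tau_eq (hlam : 0 < P.lam) (t : ℕ) :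
    (P.tau φ ν (t + 1))⁻¹ = P.leverage φ ν (t + 1) / P.τ₀ := by
  have h := leverage_sq_mul (φ := φ) (ν := ν) hlam t
  have hpos : 0 < Real.sqrt (1 + P.weight φ ν (t + 1) ^ 2) := Real.sqrt_pos.2 (by positivity)
  have h2 : P.leverage φ ν (t + 1) * Real.sqrt (1 + P.weight φ ν (t + 1) ^ 2) =
      P.weight φ ν (t + 1) := by
    refine (pow_left_inj₀ (mul_nonneg (leverage_nonneg _) hpos.le) (weight_nonneg _)
      two_ne_zero).1 ?_
    rw [mul_pow, Real.sq_sqrt (by positivity), h]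
  have h3 := mul_div_mul_right (P.leverage φ ν (t + 1)) P.τ₀ hpos.ne'
  rw [h2] at h3
  rw [tau, inv_div, h3]

lemma weight_mul_sigma (hσ : 0 < P.sigmaMin) (t : ℕ) :
    P.weight φ ν (t + 1) * P.sigma φ ν (t + 1) =
      matNorm (P.shape φ ν t)⁻¹ (φ (t + 1)) := by
  have h : 0 < P.sigma φ ν (t + 1) := hσ.trans_le (sigmaMin_le_sigma _)
  rw [weight_succ, scaled, matNorm_smul, abs_of_pos (inv_pos.2 h)]
  field_simp

/-- The third entry of the maximum defining `σ_t` exists for this. -/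
lemma weight_le_c₀ (hσ : 0 < P.sigmaMin) (hc : 0 < P.c₀) (t : ℕ) :
    P.weight φ ν (t + 1) ≤ P.c₀ := by
  have h : 0 < P.sigma φ ν (t + 1) := hσ.trans_le (sigmaMin_le_sigma _)
  have h1 : matNorm (P.shape φ ν t)⁻¹ (φ (t + 1)) / P.c₀ ≤ P.sigma φ ν (t + 1) :=
    (le_max_left _ _).trans (le_max_right _ _)
  rw [div_le_iff₀ hc, ← weight_mul_sigma hσ, mul_comm] at h1
  exact le_of_mul_le_mul_left h1 h

lemma sq_quartic_term {a n c e : ℝ} (ha : 0 ≤ a) (hn : 0 ≤ n) (hc : 0 ≤ c) (he : 0 ≤ e) :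
    (Real.sqrt a * Real.sqrt n / (c ^ (1 / 4 : ℝ) * e ^ (1 / 4 : ℝ))) ^ 2 =
      a * n / Real.sqrt (c * e) := by
  rw [div_pow, mul_pow, Real.sq_sqrt ha, Real.sq_sqrt hn, ← Real.mul_rpow hc he,
    ← Real.rpow_natCast, ← Real.rpow_mul (mul_nonneg hc he), Real.sqrt_eq_rpow]
  norm_num

/-- Squaring the fourth entry of the maximum gives `σ² √(c₁ d) ≥ LB ‖φ‖ = LB w σ`, the norm being
taken for the inverse shape matrix; one factor `σ` cancels. -/
lemma mul_weight_le_sigma (hd : 0 < P.d) (hσ : 0 < P.sigmaMin) (hc : 0 < P.c₁)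
    (hLB : 0 ≤ P.L * P.B) (t : ℕ) :
    P.L * P.B * P.weight φ ν (t + 1) ≤ P.sigma φ ν (t + 1) * Real.sqrt (P.c₁ * P.d) := by
  have h : 0 < P.sigma φ ν (t + 1) := hσ.trans_le (sigmaMin_le_sigma _)
  have hd' : (0 : ℝ) < P.d := by exact_mod_cast hd
  have h1 : Real.sqrt (P.L * P.B) * Real.sqrt (matNorm (P.shape φ ν t)⁻¹ (φ (t + 1)))
        / (P.c₁ ^ (1 / 4 : ℝ) * (P.d : ℝ) ^ (1 / 4 : ℝ)) ≤ P.sigma φ ν (t + 1) :=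
    (le_max_right _ _).trans (le_max_right _ _)
  have h2 := pow_le_pow_left₀ (by positivity) h1 2
  rw [sq_quartic_term hLB (matNorm_nonneg _ _) hc.le hd'.le,
    div_le_iff₀ (Real.sqrt_pos.2 (by positivity)), ← weight_mul_sigma hσ] at h2
  refine le_of_mul_le_mul_left ?_ h
  linarith

lemma log_det_shape (hlam : 0 < P.lam) (t : ℕ) :
    Real.log (P.shape φ ν t).det =
      P.d * Real.log P.lam + ∑ s ∈ Finset.range t, Real.log (1 + P.weight φ ν (s + 1) ^ 2) := by
  induction t with
  | zero => simp [shape]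
  | succ t ih =>
    rw [shape_succ, det_add_vecMulVec (shape_posDef hlam t),
      Real.log_mul (shape_posDef hlam t).det_pos.ne' (by positivity), ih, Finset.sum_range_succ,
      weight_succ]
    ring

lemma trace_shape (t : ℕ) :
    (P.shape φ ν t).trace =
      P.d * P.lam + ∑ s ∈ Finset.range t, ‖P.scaled φ ν (s + 1)‖ ^ 2 := by
  induction t with
  | zero => simp [shape, mul_comm]
  | succ t ih =>
    rw [shape_succ, Matrix.trace_add, ih, Matrix.trace_vecMulVec, ← real_inner_eq_dotProduct,
      real_inner_self_eq_norm_sq, Finset.sum_range_succ]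
    ring

lemma norm_scaled_le (hσ : 0 < P.sigmaMin) {t : ℕ} (hφ : ‖φ (t + 1)‖ ≤ P.L) :
    ‖P.scaled φ ν (t + 1)‖ ≤ P.L / P.sigmaMin := by
  have h : 0 < P.sigma φ ν (t + 1) := hσ.trans_le (sigmaMin_le_sigma _)
  rw [scaled, norm_smul, norm_inv, Real.norm_of_nonneg h.le, inv_mul_eq_div]
  exact div_le_div₀ ((norm_nonneg _).trans hφ) hφ hσ (sigmaMin_le_sigma _)

/-- The elliptical potential lemma. -/
lemma sum_log_one_add_weight_sq_le (hd : 0 < P.d) (hlam : 0 < P.lam) (hσ : 0 < P.sigmaMin)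
    (hφ : ∀ t < P.T, ‖φ (t + 1)‖ ≤ P.L) :
    ∑ s ∈ Finset.range P.T, Real.log (1 + P.weight φ ν (s + 1) ^ 2) ≤ P.kappa := by
  have hd' : (0 : ℝ) < P.d := by exact_mod_cast hd
  have h1 := (shape_posDef (φ := φ) (ν := ν) hlam P.T).log_det_le hd
  rw [log_det_shape hlam] at h1
  have htr : (P.shape φ ν P.T).trace ≤ P.d * P.lam + P.T * (P.L / P.sigmaMin) ^ 2 := by
    rw [trace_shape]
    gcongr
    calc _ ≤ ∑ s ∈ Finset.range P.T, (P.L / P.sigmaMin) ^ 2 :=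
          Finset.sum_le_sum fun s hs => by
            have := norm_scaled_le (ν := ν) hσ (hφ s (Finset.mem_range.1 hs))
            gcongr
      _ = _ := by simp
  have htr0 : 0 < (P.shape φ ν P.T).trace := by
    rw [trace_shape]
    positivity
  have h2 : Real.log ((P.shape φ ν P.T).trace / P.d) ≤
      Real.log P.lam +
        Real.log (1 + (P.T : ℝ) * P.L ^ 2 / ((P.d : ℝ) * P.lam * P.sigmaMin ^ 2)) := by
    rw [← Real.log_mul hlam.ne' (by positivity)]
    refine Real.log_le_log (by positivity) ?_
    rw [div_le_iff₀ hd']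
    refine htr.trans_eq ?_
    field_simp
  rw [kappa]
  nlinarith [mul_le_mul_of_nonneg_left h2 hd'.le]

lemma kappa_nonneg (hlam : 0 < P.lam) : 0 ≤ P.kappa := by
  rw [kappa]
  refine mul_nonneg (Nat.cast_nonneg _) (Real.log_nonneg ?_)
  have : 0 ≤ (P.T : ℝ) * P.L ^ 2 / ((P.d : ℝ) * P.lam * P.sigmaMin ^ 2) := by positivity
  linarith

/-- By Sherman–Morrison `p² = 1 - 1 / (1 + w²)`, which is at most `log (1 + w²)`. -/
lemma sum_leverage_sq_le (hd : 0 < P.d) (hlam : 0 < P.lam) (hσ : 0 < P.sigmaMin)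
    (hφ : ∀ t < P.T, ‖φ (t + 1)‖ ≤ P.L) {t : ℕ} (ht : t ≤ P.T) :
    ∑ s ∈ Finset.range t, P.leverage φ ν (s + 1) ^ 2 ≤ P.kappa := by
  refine le_trans ?_ (sum_log_one_add_weight_sq_le (ν := ν) hd hlam hσ hφ)
  refine (Finset.sum_le_sum_of_subset_of_nonneg (Finset.range_mono ht)
    fun _ _ _ => sq_nonneg _).trans (Finset.sum_le_sum fun s _ => ?_)
  rw [leverage_sq_eq hlam]
  exact Real.one_sub_inv_le_log_of_pos (by positivity)

/-- Since `w ≤ c₀ ≤ 1`, the identity `w² = p² (1 + w²)` gives `w² ≤ 2 p²`. -/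
lemma sum_weight_sq_le (hd : 0 < P.d) (hlam : 0 < P.lam) (hσ : 0 < P.sigmaMin)
    (hc : 0 < P.c₀) (hc1 : P.c₀ ≤ 1) (hφ : ∀ t < P.T, ‖φ (t + 1)‖ ≤ P.L) :
    ∑ s ∈ Finset.range P.T, P.weight φ ν (s + 1) ^ 2 ≤ 2 * P.kappa := by
  have h := sum_leverage_sq_le (ν := ν) hd hlam hσ hφ le_rfl
  refine le_trans (Finset.sum_le_sum fun s _ => ?_)
    ((Finset.mul_sum _ _ _).symm.trans_le (mul_le_mul_of_nonneg_left h zero_le_two))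
  have h1 := leverage_sq_mul (φ := φ) (ν := ν) hlam s
  have h2 : P.weight φ ν (s + 1) ^ 2 ≤ 1 :=
    pow_le_one₀ (weight_nonneg _) ((weight_le_c₀ hσ hc s).trans hc1)
  nlinarith [sq_nonneg (P.leverage φ ν (s + 1))]

end AdaOFULParams

/-! ### Deterministic analysis: optimality, estimation error and regret. -/

namespace AdaOFULParams

variable {P : AdaOFULParams} {φ : ℕ → Vec P.d} {ν : ℕ → ℝ}

lemma residual_eq {y ε : ℕ → ℝ} {θs : Vec P.d} {s : ℕ}
    (hy : y (s + 1) = ⟪φ (s + 1), θs⟫ + ε (s + 1)) (x Δ : Vec P.d) (h : ℝ) :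
    (y (s + 1) - ⟪φ (s + 1), x - h • Δ⟫) / P.sigma φ ν (s + 1) =
      ε (s + 1) / P.sigma φ ν (s + 1) - ⟪P.scaled φ ν (s + 1), x - θs⟫
        + h * ⟪P.scaled φ ν (s + 1), Δ⟫ := by
  rw [hy, scaled, real_inner_smul_left, real_inner_smul_left, inner_sub_right, inner_sub_right,
    real_inner_smul_right]
  ring

lemma hasDerivAt_pseudoHuber_line (hlam : 0 < P.lam) (hτ₀ : 0 < P.τ₀) (t : ℕ) (r : ℝ)
    (v : Vec P.d) :
    HasDerivAt (fun h : ℝ => pseudoHuber (P.tau φ ν (t + 1))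
        (r + h * ⟪P.scaled φ ν (t + 1), v⟫))
      (huberScore (P.leverage φ ν (t + 1) / P.τ₀) r * ⟪P.scaled φ ν (t + 1), v⟫) 0 := by
  rcases (weight_nonneg (P := P) (φ := φ) (ν := ν) (t + 1)).eq_or_lt with h0 | h0
  -- With zero weight `τ` has a meaningless value, but the summand is constant along the line, so
  -- both derivatives vanish.
  · have hX : ⟪P.scaled φ ν (t + 1), v⟫ = 0 := by
      have := abs_inner_le_matNorm_inv_mul (shape_posDef (φ := φ) (ν := ν) hlam t)
        (P.scaled φ ν (t + 1)) v
      rw [← weight_succ, ← h0, zero_mul] at this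
      exact abs_nonpos_iff.1 this
    simp only [hX, mul_zero]
    exact hasDerivAt_const _ _
  · have hτ : 0 < P.tau φ ν (t + 1) :=
      div_pos (mul_pos hτ₀ (Real.sqrt_pos.2 (by positivity))) h0
    rw [← inv_tau_eq hlam]
    have hin : HasDerivAt (fun h : ℝ => r + h * ⟪P.scaled φ ν (t + 1), v⟫)
        ⟪P.scaled φ ν (t + 1), v⟫ 0 := by
      simpa using ((hasDerivAt_id (0 : ℝ)).mul_const ⟪P.scaled φ ν (t + 1), v⟫).const_add r
    have hout := hasDerivAt_pseudoHuber hτ (r + 0 * ⟪P.scaled φ ν (t + 1), v⟫)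
    have := hout.comp 0 hin
    simpa [Function.comp_def] using this

/-- First-order optimality of the constrained estimator in the direction of the true parameter. -/
lemma first_order_optimality (hlam : 0 < P.lam) (hτ₀ : 0 < P.τ₀) {y ε : ℕ → ℝ}
    {θs x : Vec P.d} {t : ℕ} (hy : ∀ s < t, y (s + 1) = ⟪φ (s + 1), θs⟫ + ε (s + 1))
    (hθs : ‖θs‖ ≤ P.B) (hx : ‖x‖ ≤ P.B)
    (hmin : ∀ x' : Vec P.d, ‖x'‖ ≤ P.B → P.objective φ ν y t x ≤ P.objective φ ν y t x') :
    P.lam * ⟪x, x - θs⟫ ≤ ∑ s ∈ Finset.range t,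
      huberScore (P.leverage φ ν (s + 1) / P.τ₀)
          (ε (s + 1) / P.sigma φ ν (s + 1) - ⟪P.scaled φ ν (s + 1), x - θs⟫) *
        ⟪P.scaled φ ν (s + 1), x - θs⟫ := by
  set Δ := x - θs with hΔ
  have hobj : ∀ h : ℝ, P.objective φ ν y t (x - h • Δ) =
      P.lam / 2 * (‖x‖ ^ 2 - 2 * h * ⟪x, Δ⟫ + h ^ 2 * ‖Δ‖ ^ 2) +
      ∑ s ∈ Finset.range t, pseudoHuber (P.tau φ ν (s + 1))
        (ε (s + 1) / P.sigma φ ν (s + 1) - ⟪P.scaled φ ν (s + 1), Δ⟫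
          + h * ⟪P.scaled φ ν (s + 1), Δ⟫) := by
    intro h
    rw [objective, sum_Icc_one_eq_sum_range]
    congr 1
    · rw [@norm_sub_sq_real, real_inner_smul_right, norm_smul, mul_pow, Real.norm_eq_abs, sq_abs]
      ring
    · refine Finset.sum_congr rfl fun s hs => ?_
      rw [residual_eq (hy s (Finset.mem_range.1 hs))]
  have hquad : HasDerivAt
      (fun h : ℝ => P.lam / 2 * (‖x‖ ^ 2 - 2 * h * ⟪x, Δ⟫ + h ^ 2 * ‖Δ‖ ^ 2))
      (-(P.lam * ⟪x, Δ⟫)) 0 := by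
    have h1 := ((((hasDerivAt_id (0 : ℝ)).const_mul 2).mul_const ⟪x, Δ⟫).const_sub (‖x‖ ^ 2)).add
      (((hasDerivAt_id (0 : ℝ)).pow 2).mul_const (‖Δ‖ ^ 2))
    refine (h1.const_mul (P.lam / 2)).congr_deriv ?_
    simp
    ring
  have hder := hquad.add (HasDerivAt.fun_sum fun s (_ : s ∈ Finset.range t) =>
    hasDerivAt_pseudoHuber_line (φ := φ) (ν := ν) hlam hτ₀ s
      (ε (s + 1) / P.sigma φ ν (s + 1) - ⟪P.scaled φ ν (s + 1), Δ⟫) Δ)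
  have hnn := nonneg_of_hasDerivAt_of_forall_le hder fun h hh => by
    have hb : ‖x - h • Δ‖ ≤ P.B := by
      -- The segment from the estimator to the true parameter stays in the ball by convexity; only
      -- `h` in `[0, 1]` is admissible, hence the one-sided test.
      have e : x - h • Δ = (1 - h) • x + h • θs := by rw [hΔ]; module
      have := (convex_closedBall (0 : Vec P.d) P.B) (mem_closedBall_zero_iff.2 hx)
        (mem_closedBall_zero_iff.2 hθs) (sub_nonneg.2 hh.2) hh.1 (sub_add_cancel 1 h)
      rw [e]
      exact mem_closedBall_zero_iff.1 this
    have h0 := hobj 0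
    rw [zero_smul, sub_zero] at h0
    have := hmin _ hb
    rw [hobj h, h0] at this
    exact this
  linarith

lemma inner_noiseSum (ε : ℕ → ℝ) (t : ℕ) (v : Vec P.d) :
    ⟪P.noiseSum φ ν ε t, v⟫ = ∑ s ∈ Finset.range t,
      P.noiseScore φ ν ε (s + 1) * ⟪P.scaled φ ν (s + 1), v⟫ := by
  simp [noiseSum, sum_inner, real_inner_smul_left]

/-- The deterministic part of the confidence bound: if the rounds with large noise carry little
leverage and the shift of every residual is small, the estimation error is controlled by the
gradient of the objective at the true parameter. -/
lemma estimation_error_le (hlam : 0 < P.lam) (hτ₀ : 0 < P.τ₀) {y ε : ℕ → ℝ}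
    {θs x : Vec P.d} {t : ℕ} (hy : ∀ s < t, y (s + 1) = ⟪φ (s + 1), θs⟫ + ε (s + 1))
    (hθs : ‖θs‖ ≤ P.B) (hx : ‖x‖ ≤ P.B)
    (hmin : ∀ x' : Vec P.d, ‖x'‖ ≤ P.B → P.objective φ ν y t x ≤ P.objective φ ν y t x')
    (hshift : ∀ s < t,
      P.leverage φ ν (s + 1) / P.τ₀ * |⟪P.scaled φ ν (s + 1), x - θs⟫| ≤ 1 / 2)
    (hlarge : ∑ s ∈ Finset.range t,
      P.leverage φ ν (s + 1) ^ 2 * P.largeNoise φ ν ε (s + 1) ≤ 1 / 20) :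
    matNorm (P.shape φ ν t) (x - θs) ≤
      4 * (matNorm (P.shape φ ν t)⁻¹ (P.noiseSum φ ν ε t) + Real.sqrt P.lam * P.B) := by
  set Δ := x - θs with hΔ
  set N := matNorm (P.shape φ ν t) Δ with hN
  have hN0 : 0 ≤ N := matNorm_nonneg _ _
  have hfo := first_order_optimality (φ := φ) (ν := ν) hlam hτ₀ hy hθs hx hmin
  rw [← hΔ] at hfo
  have hNsq : N ^ 2 = P.lam * ‖Δ‖ ^ 2 + ∑ s ∈ Finset.range t, ⟪P.scaled φ ν (s + 1), Δ⟫ ^ 2 :=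
    matNorm_shape_sq hlam t Δ
  have hcurv : ∀ s ∈ Finset.range t,
      7 / 20 * ⟪P.scaled φ ν (s + 1), Δ⟫ ^ 2 -
        7 / 20 * N ^ 2 * (P.leverage φ ν (s + 1) ^ 2 * P.largeNoise φ ν ε (s + 1)) ≤
      P.noiseScore φ ν ε (s + 1) * ⟪P.scaled φ ν (s + 1), Δ⟫ -
      huberScore (P.leverage φ ν (s + 1) / P.τ₀)
          (ε (s + 1) / P.sigma φ ν (s + 1) - ⟪P.scaled φ ν (s + 1), Δ⟫) *
        ⟪P.scaled φ ν (s + 1), Δ⟫ := by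
    intro s hs
    have hst := Finset.mem_range.1 hs
    have h1 := huberScore_shift_ge (z := ε (s + 1) / P.sigma φ ν (s + 1))
      (div_nonneg (leverage_nonneg _) hτ₀.le) (hshift s hst)
    -- The curvature lost in an outlier round is at most `N²` times its squared leverage: duality
    -- for `H_{s+1}`, then monotonicity of the shape matrices up to `H_t`.
    have h2 : ⟪P.scaled φ ν (s + 1), Δ⟫ ^ 2 ≤ N ^ 2 * P.leverage φ ν (s + 1) ^ 2 := by
      rw [← mul_pow, ← sq_abs]
      refine pow_le_pow_left₀ (abs_nonneg _) ?_ 2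
      refine (abs_inner_le_matNorm_inv_mul (shape_posDef (φ := φ) (ν := ν) hlam (s + 1)) _ _).trans
        ?_
      rw [mul_comm]
      exact mul_le_mul_of_nonneg_right (matNorm_shape_mono hlam hst Δ) (matNorm_nonneg _ _)
    have h3 : 0 ≤ P.largeNoise φ ν ε (s + 1) := by unfold largeNoise; split_ifs <;> norm_num
    have h4 := mul_le_mul_of_nonneg_right h2 h3
    rw [← sub_mul]
    change 7 / 20 * _ * (1 - P.largeNoise φ ν ε (s + 1)) ≤
      (P.noiseScore φ ν ε (s + 1) - _) * _ at h1
    linarith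
  have hsum := Finset.sum_le_sum hcurv
  rw [Finset.sum_sub_distrib, Finset.sum_sub_distrib, ← Finset.mul_sum, ← Finset.mul_sum,
    ← inner_noiseSum] at hsum
  have hnoise : ⟪P.noiseSum φ ν ε t, Δ⟫ ≤
      matNorm (P.shape φ ν t)⁻¹ (P.noiseSum φ ν ε t) * N :=
    le_of_abs_le (abs_inner_le_matNorm_inv_mul (shape_posDef hlam t) _ _)
  have hridge : -⟪θs, Δ⟫ * P.lam ≤ Real.sqrt P.lam * P.B * N := by
    have h1 : Real.sqrt P.lam * ‖Δ‖ ≤ N := by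
      refine abs_le_of_sq_le_sq' ?_ hN0 |>.2
      rw [mul_pow, Real.sq_sqrt hlam.le, hNsq]
      exact le_add_of_nonneg_right (Finset.sum_nonneg fun _ _ => sq_nonneg _)
    have h2 : -⟪θs, Δ⟫ ≤ P.B * ‖Δ‖ :=
      (neg_le_abs _).trans ((abs_real_inner_le_norm _ _).trans (by gcongr))
    have hB : 0 ≤ P.B := (norm_nonneg _).trans hθs
    calc -⟪θs, Δ⟫ * P.lam ≤ P.B * ‖Δ‖ * P.lam := by gcongr
      _ = Real.sqrt P.lam * P.B * (Real.sqrt P.lam * ‖Δ‖) := by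
        linear_combination (-(P.B * ‖Δ‖)) * Real.mul_self_sqrt hlam.le
      _ ≤ Real.sqrt P.lam * P.B * N := by gcongr
  have hinner : ⟪x, Δ⟫ = ‖Δ‖ ^ 2 + ⟪θs, Δ⟫ := by
    rw [← real_inner_self_eq_norm_sq, ← inner_add_left, hΔ, sub_add_cancel]
  rw [hinner] at hfo
  have hl := mul_le_mul_of_nonneg_left hlarge (show 0 ≤ 7 / 20 * N ^ 2 by positivity)
  have hlΔ : 0 ≤ P.lam * ‖Δ‖ ^ 2 := by positivity
  -- The surviving curvature is `7/20 · (1 - 1/20) = 133/400`, which is at least `1/4`.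
  have hmain : N ^ 2 / 4 ≤
      (matNorm (P.shape φ ν t)⁻¹ (P.noiseSum φ ν ε t) + Real.sqrt P.lam * P.B) * N := by
    nlinarith [sq_nonneg N]
  rcases hN0.eq_or_lt with h0 | h0
  · rw [← h0]
    have hB : 0 ≤ P.B := (norm_nonneg _).trans hθs
    have := matNorm_nonneg (P.shape φ ν t)⁻¹ (P.noiseSum φ ν ε t)
    positivity
  · refine le_of_mul_le_mul_right ?_ h0
    linarith

lemma sqrt_lam_mul_le_beta (hδ : 0 < P.δ) (hδ1 : P.δ < 1) (hlam : 0 < P.lam) (hB : 0 ≤ P.B)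
    (hτ₀ : 0 < P.τ₀) (t : ℕ) : Real.sqrt P.lam * P.B ≤ P.beta t := by
  cases t with
  | zero => exact le_rfl
  | succ t =>
    have hl : 0 ≤ Real.log (2 * ((t + 1 : ℕ) : ℝ) ^ 2 / P.δ) := by
      refine Real.log_nonneg ((one_le_div hδ).2 ?_)
      have : (1 : ℝ) ≤ ((t + 1 : ℕ) : ℝ) ^ 2 := one_le_pow₀ (by exact_mod_cast Nat.le_add_left 1 t)
      linarith
    have hk := kappa_nonneg (P := P) hlam
    have h1 : 0 ≤ 32 * (P.kappa / P.τ₀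
          + Real.sqrt (P.kappa * Real.log (2 * ((t + 1 : ℕ) : ℝ) ^ 2 / P.δ))
          + P.τ₀ * Real.log (2 * ((t + 1 : ℕ) : ℝ) ^ 2 / P.δ)) := by positivity
    have h2 : 0 ≤ Real.sqrt P.lam * P.B := by positivity
    rw [beta]
    linarith

lemma beta_mono (hδ : 0 < P.δ) (hδ1 : P.δ < 1) (hlam : 0 < P.lam) (hB : 0 ≤ P.B)
    (hτ₀ : 0 < P.τ₀) : Monotone P.beta := by
  refine monotone_nat_of_le_succ fun t => ?_
  cases t with
  | zero => exact sqrt_lam_mul_le_beta hδ hδ1 hlam hB hτ₀ 1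
  | succ t =>
    have hl : Real.log (2 * ((t + 1 : ℕ) : ℝ) ^ 2 / P.δ) ≤
        Real.log (2 * ((t + 1 + 1 : ℕ) : ℝ) ^ 2 / P.δ) := by
      refine Real.log_le_log (by positivity) ?_
      gcongr
      exact Nat.le_succ _
    have hk := kappa_nonneg (P := P) hlam
    simp only [beta]
    gcongr

/-- The regret of the optimistic play while the true parameter lies in the confidence sets. -/
lemma regret_le_of_mem_confSet (hδ : 0 < P.δ) (hδ1 : P.δ < 1) (hlam : 0 < P.lam)
    (hB : 0 ≤ P.B) (hτ₀ : 0 < P.τ₀) (hσ : 0 < P.sigmaMin) {D : ℕ → Set (Vec P.d)}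
    {y : ℕ → ℝ} {θ : ℕ → Vec P.d} {θs : Vec P.d} (hrun : P.IsAdaOFULRun D φ ν y θ)
    (hmem : ∀ t < P.T, θs ∈ P.confSet φ ν θ t) :
    regret P.T D θs φ ≤ 2 * P.beta P.T *
      ∑ t ∈ Finset.range P.T, P.weight φ ν (t + 1) * P.sigma φ ν (t + 1) := by
  rw [regret, sum_Icc_one_eq_sum_range, Finset.mul_sum]
  refine Finset.sum_le_sum fun t ht => ?_
  have htT := Finset.mem_range.1 ht
  obtain ⟨hφD, x, hx, hopt⟩ := hrun.optimism t htT
  have hsup : sSup ((fun x : Vec P.d => ⟪x, θs⟫) '' D (t + 1)) ≤ ⟪φ (t + 1), x⟫ := by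
    refine csSup_le (Set.Nonempty.image _ ⟨_, hφD⟩) ?_
    rintro _ ⟨φ', hφ', rfl⟩
    exact hopt φ' hφ' θs (hmem t htT)
  have hpd := shape_posDef (φ := φ) (ν := ν) hlam t
  have h1 := le_of_abs_le (abs_inner_le_matNorm_inv_mul hpd (φ (t + 1)) (x - θs))
  have h2 : matNorm (P.shape φ ν t) (x - θs) ≤ 2 * P.beta P.T := by
    have e : x - θs = (x - θ t) - (θs - θ t) := by abel
    have hb := beta_mono hδ hδ1 hlam hB hτ₀ htT.le
    rw [e]
    have := matNorm_sub_le hpd.posSemidef (x - θ t) (θs - θ t)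
    linarith [hx.2, (hmem t htT).2]
  rw [weight_mul_sigma hσ]
  rw [inner_sub_right] at h1
  nlinarith [mul_le_mul_of_nonneg_left h2 (matNorm_nonneg (P.shape φ ν t)⁻¹ (φ (t + 1)))]

/-- Each summand accounts for one way of attaining the maximum in `σ_t`. For `ν` or `σ_min` the
first suffices. For the third entry `w = c₀`, while `w σ` is the norm of `φ`, at most `L / √λ`. For
the fourth entry `σ = LB w / √(c₁ d)` when `w σ` is substituted for the norm. -/
lemma weight_mul_sigma_le (hd : 0 < P.d) (hlam : 0 < P.lam) (hσ : 0 < P.sigmaMin)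
    (hc0 : 0 < P.c₀) (hc1 : 0 < P.c₁) (hL : 0 ≤ P.L) (hB : 0 ≤ P.B) {t : ℕ}
    (hφ : ‖φ (t + 1)‖ ≤ P.L) :
    P.weight φ ν (t + 1) * P.sigma φ ν (t + 1) ≤
      P.weight φ ν (t + 1) * Real.sqrt (ν (t + 1) ^ 2 + P.sigmaMin ^ 2) +
      P.L / (P.c₀ ^ 2 * Real.sqrt P.lam) * P.weight φ ν (t + 1) ^ 2 +
      P.L * P.B / Real.sqrt (P.c₁ * P.d) * P.weight φ ν (t + 1) ^ 2 := by
  have hd' : (0 : ℝ) < P.d := by exact_mod_cast hd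
  have hw := weight_nonneg (P := P) (φ := φ) (ν := ν) (t + 1)
  have hσt : 0 < P.sigma φ ν (t + 1) := hσ.trans_le (sigmaMin_le_sigma _)
  have hws := weight_mul_sigma (φ := φ) (ν := ν) hσ t
  set w := P.weight φ ν (t + 1)
  set n := matNorm (P.shape φ ν t)⁻¹ (φ (t + 1)) with hn
  have hn0 : 0 ≤ n := matNorm_nonneg _ _
  have ha : 0 ≤ w * Real.sqrt (ν (t + 1) ^ 2 + P.sigmaMin ^ 2) := by positivity
  have hb : 0 ≤ P.L / (P.c₀ ^ 2 * Real.sqrt P.lam) * w ^ 2 := by positivity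
  have hc : 0 ≤ P.L * P.B / Real.sqrt (P.c₁ * P.d) * w ^ 2 := by positivity
  have hdef : P.sigma φ ν (t + 1) = max (max (ν (t + 1)) P.sigmaMin) (max (n / P.c₀)
      (Real.sqrt (P.L * P.B) * Real.sqrt n / (P.c₁ ^ (1 / 4 : ℝ) * (P.d : ℝ) ^ (1 / 4 : ℝ)))) :=
    rfl
  rcases max_choice (max (ν (t + 1)) P.sigmaMin) (max (n / P.c₀)
      (Real.sqrt (P.L * P.B) * Real.sqrt n / (P.c₁ ^ (1 / 4 : ℝ) * (P.d : ℝ) ^ (1 / 4 : ℝ))))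
    with h | h
  · have h1 : P.sigma φ ν (t + 1) ≤ Real.sqrt (ν (t + 1) ^ 2 + P.sigmaMin ^ 2) := by
      rw [hdef, h]
      exact max_le (Real.le_sqrt_of_sq_le (by nlinarith)) (Real.le_sqrt_of_sq_le (by nlinarith))
    have := mul_le_mul_of_nonneg_left h1 hw
    linarith
  · rw [h] at hdef
    rcases max_choice (n / P.c₀)
      (Real.sqrt (P.L * P.B) * Real.sqrt n / (P.c₁ ^ (1 / 4 : ℝ) * (P.d : ℝ) ^ (1 / 4 : ℝ)))
      with h' | h'
    · rw [h'] at hdef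
      have hwc : w = P.c₀ := by
        have h1 : P.sigma φ ν (t + 1) * P.c₀ = n := by rw [hdef]; field_simp
        refine mul_right_cancel₀ hσt.ne' ?_
        rw [hws, ← h1, mul_comm]
      have h2 : n ≤ P.L / Real.sqrt P.lam :=
        (matNorm_inv_shape_le hlam t _).trans (by gcongr)
      have h3 : P.L / (P.c₀ ^ 2 * Real.sqrt P.lam) * w ^ 2 = P.L / Real.sqrt P.lam := by
        rw [hwc]
        field_simp
      rw [hws]
      linarith
    · rw [h'] at hdef
      have h1 := sq_quartic_term (mul_nonneg hL hB) hn0 hc1.le hd'.le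
      rw [← hdef, ← hws] at h1
      have h2 : P.L * P.B / Real.sqrt (P.c₁ * P.d) * w ^ 2 = w * P.sigma φ ν (t + 1) := by
        refine mul_right_cancel₀ hσt.ne' ?_
        rw [mul_assoc w, ← sq, h1]
        ring
      linarith

lemma sum_weight_mul_sigma_le (hd : 0 < P.d) (hT : 0 < P.T) (hlam : 0 < P.lam)
    (hσ : P.sigmaMin = 1 / Real.sqrt (P.T : ℝ)) (hc0 : 0 < P.c₀) (hc01 : P.c₀ ≤ 1)
    (hc1 : 0 < P.c₁) (hL : 0 ≤ P.L) (hB : 0 ≤ P.B)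
    (hφ : ∀ t < P.T, ‖φ (t + 1)‖ ≤ P.L) :
    ∑ t ∈ Finset.range P.T, P.weight φ ν (t + 1) * P.sigma φ ν (t + 1) ≤
      Real.sqrt (2 * P.kappa) * Real.sqrt ((∑ t ∈ Finset.Icc 1 P.T, (ν t) ^ 2) + 1)
        + 2 * P.L * P.kappa / (P.c₀ ^ 2 * Real.sqrt P.lam)
        + 2 * P.L * P.B * P.kappa / Real.sqrt (P.c₁ * (P.d : ℝ)) := by
  have hT' : (0 : ℝ) < P.T := by exact_mod_cast hT
  have hσ0 : 0 < P.sigmaMin := by rw [hσ]; positivity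
  have hsq := sum_weight_sq_le (ν := ν) hd hlam hσ0 hc0 hc01 hφ
  refine (Finset.sum_le_sum fun t ht => weight_mul_sigma_le hd hlam hσ0 hc0 hc1 hL hB
    (hφ t (Finset.mem_range.1 ht))).trans ?_
  rw [Finset.sum_add_distrib, Finset.sum_add_distrib, ← Finset.mul_sum, ← Finset.mul_sum]
  have h1 : ∑ t ∈ Finset.range P.T,
      P.weight φ ν (t + 1) * Real.sqrt (ν (t + 1) ^ 2 + P.sigmaMin ^ 2) ≤
      Real.sqrt (2 * P.kappa) * Real.sqrt ((∑ t ∈ Finset.Icc 1 P.T, (ν t) ^ 2) + 1) := by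
    refine (Real.sum_mul_le_sqrt_mul_sqrt _ _ _).trans ?_
    refine mul_le_mul (Real.sqrt_le_sqrt hsq) (Real.sqrt_le_sqrt (le_of_eq ?_))
      (Real.sqrt_nonneg _) (Real.sqrt_nonneg _)
    rw [sum_Icc_one_eq_sum_range]
    simp_rw [fun t => Real.sq_sqrt (add_nonneg (sq_nonneg (ν (t + 1))) (sq_nonneg P.sigmaMin))]
    rw [Finset.sum_add_distrib]
    -- The floors `σ_min² = 1 / T` add up to 1 over the `T` rounds.
    simp [hσ, hT'.ne']
  have h2 := mul_le_mul_of_nonneg_left hsq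
    (show 0 ≤ P.L / (P.c₀ ^ 2 * Real.sqrt P.lam) by positivity)
  have h3 := mul_le_mul_of_nonneg_left hsq
    (show 0 ≤ P.L * P.B / Real.sqrt (P.c₁ * P.d) by positivity)
  have e2 : P.L / (P.c₀ ^ 2 * Real.sqrt P.lam) * (2 * P.kappa) =
      2 * P.L * P.kappa / (P.c₀ ^ 2 * Real.sqrt P.lam) := by ring
  have e3 : P.L * P.B / Real.sqrt (P.c₁ * P.d) * (2 * P.kappa) =
      2 * P.L * P.B * P.kappa / Real.sqrt (P.c₁ * P.d) := by ring
  linarith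

/-- When `T L² / (d λ σ_min²) ≤ 1` the trivial bound `2 L B T` on the regret is good enough. -/
lemma regret_le_of_ratio_le_one (hd : 0 < P.d) (hT : 0 < P.T) (hδ : 0 < P.δ) (hδ1 : P.δ < 1)
    (hlam : 0 < P.lam) (hL : 0 ≤ P.L) (hB : 0 ≤ P.B) (hτ₀ : 0 < P.τ₀)
    (hσ : P.sigmaMin = 1 / Real.sqrt (P.T : ℝ))
    (hr : (P.T : ℝ) * P.L ^ 2 / ((P.d : ℝ) * P.lam * P.sigmaMin ^ 2) ≤ 1)
    {D : ℕ → Set (Vec P.d)} {θs : Vec P.d} (hD : ∀ t < P.T, φ (t + 1) ∈ D (t + 1))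
    (hm : ∀ t < P.T, ∀ x ∈ D (t + 1), |⟪x, θs⟫| ≤ P.L * P.B) :
    regret P.T D θs φ ≤ 2 * P.beta P.T * Real.sqrt (2 * P.kappa) := by
  have hT' : (0 : ℝ) < P.T := by exact_mod_cast hT
  have hd' : (0 : ℝ) < P.d := by exact_mod_cast hd
  have h1 : regret P.T D θs φ ≤ 2 * (P.L * P.B) * P.T := by
    rw [regret, sum_Icc_one_eq_sum_range]
    calc _ ≤ ∑ t ∈ Finset.range P.T, 2 * (P.L * P.B) := Finset.sum_le_sum fun t ht => by
            have ht' := Finset.mem_range.1 ht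
            have h2 : sSup ((fun x : Vec P.d => ⟪x, θs⟫) '' D (t + 1)) ≤ P.L * P.B := by
              refine csSup_le (Set.Nonempty.image _ ⟨_, hD t ht'⟩) ?_
              rintro _ ⟨x, hx, rfl⟩
              exact le_of_abs_le (hm t ht' x hx)
            linarith [neg_le_of_abs_le (hm t ht' _ (hD t ht'))]
      _ = _ := by simp; ring
  set r := (P.T : ℝ) * P.L ^ 2 / ((P.d : ℝ) * P.lam * P.sigmaMin ^ 2) with hrdef
  have hr0 : 0 ≤ r := by positivity
  -- `log (1 + r) ≥ r / (1 + r)`, and `r ≤ 1` here.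
  have hlog : r / 2 ≤ Real.log (1 + r) := by
    refine le_trans ?_ (Real.one_sub_inv_le_log_of_pos (by linarith))
    rw [le_sub_comm, inv_le_iff_one_le_mul₀ (by linarith)]
    nlinarith
  have hk : (P.T * P.L) ^ 2 / P.lam ≤ 2 * P.kappa := by
    -- The second factor `T` comes from `σ_min² = 1 / T`. Consequently `√(2κ) ≥ TL / √λ`, and
    -- multiplying by `β_T ≥ √λ B` recovers `LBT`.
    have e : (P.T * P.L) ^ 2 / P.lam = P.d * r := by
      rw [hrdef, hσ, div_pow, Real.sq_sqrt hT'.le]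
      field_simp
    rw [kappa, ← hrdef, e]
    nlinarith
  have h3 : P.T * P.L / Real.sqrt P.lam ≤ Real.sqrt (2 * P.kappa) := by
    refine Real.le_sqrt_of_sq_le ?_
    rwa [div_pow, Real.sq_sqrt hlam.le]
  have h4 := sqrt_lam_mul_le_beta (P := P) hδ hδ1 hlam hB hτ₀ P.T
  have hs : 0 < Real.sqrt P.lam := Real.sqrt_pos.2 hlam
  calc regret P.T D θs φ ≤ 2 * (P.L * P.B) * P.T := h1
    _ = 2 * (Real.sqrt P.lam * P.B) * (P.T * P.L / Real.sqrt P.lam) := by field_simp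
    _ ≤ 2 * P.beta P.T * Real.sqrt (2 * P.kappa) := by
      have : 0 ≤ P.beta P.T := le_trans (by positivity) h4
      gcongr

end AdaOFULParams

/-! ### Measurability of the quantities built along a run. -/

section Measurability

variable {Ω : Type*} {m : MeasurableSpace Ω} {d : ℕ}

/-- Inversion is the adjugate, which is continuous, scaled by the inverse determinant, which is
measurable also through the singular matrices. -/
lemma StronglyMeasurable.matrix_inv {M : Ω → Matrix (Fin d) (Fin d) ℝ}
    (hM : StronglyMeasurable M) : StronglyMeasurable fun ω => (M ω)⁻¹ := by
  have hdet : StronglyMeasurable fun ω => (M ω).det :=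
    (continuous_id.matrix_det).comp_stronglyMeasurable hM
  have hadj : StronglyMeasurable fun ω => (M ω).adjugate :=
    (continuous_id.matrix_adjugate).comp_stronglyMeasurable hM
  simp_rw [Matrix.inv_def, Ring.inverse_eq_inv']
  exact hdet.measurable.inv.stronglyMeasurable.smul hadj

lemma StronglyMeasurable.dotProduct_mulVec {M : Ω → Matrix (Fin d) (Fin d) ℝ} {x y : Ω → Vec d}
    (hM : StronglyMeasurable M) (hx : StronglyMeasurable x) (hy : StronglyMeasurable y) :
    StronglyMeasurable fun ω => (x ω).ofLp ⬝ᵥ (M ω *ᵥ (y ω).ofLp) := by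
  have hcont : Continuous fun q : (Vec d × Matrix (Fin d) (Fin d) ℝ) × Vec d =>
      q.1.1.ofLp ⬝ᵥ (q.1.2 *ᵥ q.2.ofLp) := by
    refine Continuous.dotProduct ?_ (Continuous.matrix_mulVec ?_ ?_) <;> fun_prop
  exact hcont.comp_stronglyMeasurable ((hx.prodMk hM).prodMk hy)

lemma StronglyMeasurable.matNorm {M : Ω → Matrix (Fin d) (Fin d) ℝ} {x : Ω → Vec d}
    (hM : StronglyMeasurable M) (hx : StronglyMeasurable x) :
    StronglyMeasurable fun ω => matNorm (M ω) (x ω) :=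
  Real.continuous_sqrt.comp_stronglyMeasurable (StronglyMeasurable.dotProduct_mulVec hM hx hx)

namespace AdaOFULParams

variable {P : AdaOFULParams} {φ : ℕ → Ω → Vec P.d} {ν ε : ℕ → Ω → ℝ} {t : ℕ}

lemma stronglyMeasurable_sigmaOf {H : Ω → Matrix (Fin P.d) (Fin P.d) ℝ} {x : Ω → Vec P.d}
    {v : Ω → ℝ} (hH : StronglyMeasurable H) (hx : StronglyMeasurable x)
    (hv : StronglyMeasurable v) :
    StronglyMeasurable fun ω => P.sigmaOf (H ω) (x ω) (v ω) := by
  have hn := (StronglyMeasurable.matNorm (StronglyMeasurable.matrix_inv hH) hx).measurable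
  refine Measurable.stronglyMeasurable ?_
  unfold sigmaOf
  exact (hv.measurable.max measurable_const).max
    ((hn.div_const _).max ((hn.sqrt.const_mul _).div_const _))

lemma stronglyMeasurable_shape (hφ : ∀ s < t, StronglyMeasurable (φ (s + 1)))
    (hν : ∀ s < t, StronglyMeasurable (ν (s + 1))) :
    StronglyMeasurable fun ω => P.shape (fun s => φ s ω) (fun s => ν s ω) t := by
  induction t with
  | zero => exact stronglyMeasurable_const
  | succ t ih =>
    have hH := ih (fun s hs => hφ s (by omega)) (fun s hs => hν s (by omega))
    have hx := hφ t t.lt_succ_self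
    have hσ := stronglyMeasurable_sigmaOf hH hx (hν t t.lt_succ_self)
    have hcont : Continuous fun x : Vec P.d => Matrix.vecMulVec x.ofLp x.ofLp := by fun_prop
    exact hH.add (((hσ.measurable.pow_const 2).inv.stronglyMeasurable).smul
      (hcont.comp_stronglyMeasurable hx))

lemma stronglyMeasurable_sigma (hφ : ∀ s ≤ t, StronglyMeasurable (φ (s + 1)))
    (hν : ∀ s ≤ t, StronglyMeasurable (ν (s + 1))) :
    StronglyMeasurable fun ω => P.sigma (fun s => φ s ω) (fun s => ν s ω) (t + 1) :=
  stronglyMeasurable_sigmaOf (stronglyMeasurable_shape (fun s hs => hφ s hs.le)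
    (fun s hs => hν s hs.le)) (hφ t le_rfl) (hν t le_rfl)

lemma stronglyMeasurable_scaled (hφ : ∀ s ≤ t, StronglyMeasurable (φ (s + 1)))
    (hν : ∀ s ≤ t, StronglyMeasurable (ν (s + 1))) :
    StronglyMeasurable fun ω => P.scaled (fun s => φ s ω) (fun s => ν s ω) (t + 1) :=
  (stronglyMeasurable_sigma hφ hν).measurable.inv.stronglyMeasurable.smul (hφ t le_rfl)

lemma stronglyMeasurable_leverage (hφ : ∀ s ≤ t, StronglyMeasurable (φ (s + 1)))
    (hν : ∀ s ≤ t, StronglyMeasurable (ν (s + 1))) :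
    StronglyMeasurable fun ω => P.leverage (fun s => φ s ω) (fun s => ν s ω) (t + 1) :=
  StronglyMeasurable.matNorm (StronglyMeasurable.matrix_inv
    (stronglyMeasurable_shape (fun s hs => hφ s (by omega)) (fun s hs => hν s (by omega))))
    (stronglyMeasurable_scaled hφ hν)

lemma stronglyMeasurable_noiseScore (hφ : ∀ s ≤ t, StronglyMeasurable (φ (s + 1)))
    (hν : ∀ s ≤ t, StronglyMeasurable (ν (s + 1))) (hε : StronglyMeasurable (ε (t + 1))) :
    StronglyMeasurable fun ω =>
      P.noiseScore (fun s => φ s ω) (fun s => ν s ω) (fun s => ε s ω) (t + 1) := by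
  have hp := (stronglyMeasurable_leverage hφ hν).measurable
  have hz := hε.measurable.div (stronglyMeasurable_sigma hφ hν).measurable
  refine Measurable.stronglyMeasurable ?_
  unfold noiseScore huberScore
  exact hz.div (((hp.div_const _).mul hz).pow_const 2 |>.const_add 1 |>.sqrt)

lemma stronglyMeasurable_largeNoise (hφ : ∀ s ≤ t, StronglyMeasurable (φ (s + 1)))
    (hν : ∀ s ≤ t, StronglyMeasurable (ν (s + 1))) (hε : StronglyMeasurable (ε (t + 1))) :
    StronglyMeasurable fun ω =>
      P.largeNoise (fun s => φ s ω) (fun s => ν s ω) (fun s => ε s ω) (t + 1) := by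
  have hp := (stronglyMeasurable_leverage hφ hν).measurable
  have hz := hε.measurable.div (stronglyMeasurable_sigma hφ hν).measurable
  refine Measurable.stronglyMeasurable ?_
  unfold largeNoise
  exact Measurable.ite (measurableSet_lt measurable_const ((hp.div_const _).mul hz.abs))
    measurable_const measurable_const

lemma stronglyMeasurable_noiseSum (hφ : ∀ s < t, StronglyMeasurable (φ (s + 1)))
    (hν : ∀ s < t, StronglyMeasurable (ν (s + 1)))
    (hε : ∀ s < t, StronglyMeasurable (ε (s + 1))) :
    StronglyMeasurable fun ω =>
      P.noiseSum (fun s => φ s ω) (fun s => ν s ω) (fun s => ε s ω) t := by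
  unfold noiseSum
  refine Finset.stronglyMeasurable_fun_sum _ fun s hs => ?_
  have hst := Finset.mem_range.1 hs
  exact (stronglyMeasurable_noiseScore (fun r hr => hφ r (by omega)) (fun r hr => hν r (by omega))
    (hε s hst)).smul (stronglyMeasurable_scaled (fun r hr => hφ r (by omega))
      (fun r hr => hν r (by omega)))

end AdaOFULParams

end Measurability

/-- Integrating a bound that is quadratic in a centred noise with conditional variance `v²`. -/
lemma integral_le_of_le_quadratic {Ω : Type*} {m mΩ : MeasurableSpace Ω} {μ : Measure Ω}
    [IsProbabilityMeasure μ] (hm : m ≤ mΩ) {Y U a b c e v : Ω → ℝ} {K : ℝ}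
    (hb : StronglyMeasurable[m] b) (hbK : ∀ ω, |b ω| ≤ K)
    (hc : StronglyMeasurable[m] c) (hcK : ∀ ω, |c ω| ≤ K)
    (ha : Integrable a μ) (hU : Integrable U μ) (hY : Integrable Y μ) (he : MemLp e 2 μ)
    (hmean : μ[e | m] =ᵐ[μ] 0)
    (hvar : μ[fun ω => e ω ^ 2 | m] =ᵐ[μ] fun ω => v ω ^ 2)
    (hle : ∀ ω, Y ω ≤ a ω + b ω * e ω + c ω * e ω ^ 2)
    (hUle : ∀ ω, a ω + c ω * v ω ^ 2 ≤ U ω) :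
    ∫ ω, Y ω ∂μ ≤ ∫ ω, U ω ∂μ := by
  have he1 : Integrable e μ := he.integrable one_le_two
  have he2 : Integrable (fun ω => e ω ^ 2) μ := he.integrable_sq
  have hbe : Integrable (b * e) μ :=
    he1.bdd_mul (hb.mono hm).aestronglyMeasurable (Filter.Eventually.of_forall hbK)
  have hce : Integrable (c * fun ω => e ω ^ 2) μ :=
    he2.bdd_mul (hc.mono hm).aestronglyMeasurable (Filter.Eventually.of_forall hcK)
  have h1 : ∫ ω, (b * e) ω ∂μ = 0 := by
    rw [← integral_condExp hm]
    refine (integral_congr_ae ((condExp_mul_of_stronglyMeasurable_left hb hbe he1).trans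
      (Filter.EventuallyEq.mul (Filter.EventuallyEq.refl _ b) hmean))).trans ?_
    simp
  have hcv := (condExp_mul_of_stronglyMeasurable_left hc hce he2).trans
      (Filter.EventuallyEq.mul (Filter.EventuallyEq.refl _ c) hvar)
  have h2 : ∫ ω, (c * fun ω => e ω ^ 2) ω ∂μ = ∫ ω, (c * fun ω => v ω ^ 2) ω ∂μ := by
    rw [← integral_condExp hm]
    exact integral_congr_ae hcv
  -- No integrability of `v²` is assumed; it is inherited from the conditional expectation of `c
  -- e²`.
  have hcvint : Integrable (c * fun ω => v ω ^ 2) μ := integrable_condExp.congr hcv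
  calc ∫ ω, Y ω ∂μ ≤ ∫ ω, (a + b * e + c * fun ω => e ω ^ 2) ω ∂μ :=
        integral_mono hY ((ha.add hbe).add hce) hle
    _ = ∫ ω, (a + c * fun ω => v ω ^ 2) ω ∂μ := by
        rw [integral_add' (ha.add hbe) hce, integral_add' ha hbe, h1, h2, integral_add' ha hcvint,
          add_zero]
    _ ≤ ∫ ω, U ω ∂μ := integral_mono (ha.add hcvint) hU hUle

/-! ### The two potentials and their one-step bounds. -/

namespace AdaOFULParams

section Potentials

variable (P : AdaOFULParams) (φ : ℕ → Vec P.d) (ν ε : ℕ → ℝ)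

/-- The compensated hyperbolic cosine of the self-normalised noise. -/
noncomputable def noisePotential (t : ℕ) : ℝ :=
  Real.exp (-(3 / 2) * ∑ s ∈ Finset.range t, (P.leverage φ ν (s + 1) / P.τ₀) ^ 2) *
    Real.cosh (matNorm (P.shape φ ν t)⁻¹ (P.noiseSum φ ν ε t) / P.τ₀)

/-- The compensated exponential of the leverage carried by the rounds with large noise. -/
noncomputable def outlierPotential (t : ℕ) : ℝ :=
  Real.exp (∑ s ∈ Finset.range t,
    (P.leverage φ ν (s + 1) ^ 2 * P.largeNoise φ ν ε (s + 1) / P.c₀ ^ 2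
      - 8 * (P.leverage φ ν (s + 1) / P.τ₀) ^ 2))

/-- The norm of the past noise with respect to the updated shape matrix, in units of `τ₀`. -/
noncomputable def pastNorm (t : ℕ) : ℝ := matNorm (P.shape φ ν (t + 1))⁻¹ (P.noiseSum φ ν ε t) / P.τ₀

/-- The coefficient of the normalised noise in the expansion of the hyperbolic cosine. -/
noncomputable def driftCoeff (t : ℕ) : ℝ :=
  Real.sinh (P.pastNorm φ ν ε t) / P.pastNorm φ ν ε t *
    ((P.noiseSum φ ν ε t).ofLp ⬝ᵥ ((P.shape φ ν (t + 1))⁻¹ *ᵥ (P.scaled φ ν (t + 1)).ofLp)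
      / P.τ₀ ^ 2)

variable {P φ ν ε}

lemma noisePotential_nonneg (t : ℕ) : 0 ≤ P.noisePotential φ ν ε t :=
  mul_nonneg (Real.exp_pos _).le (Real.cosh_pos _).le

lemma outlierPotential_nonneg (t : ℕ) : 0 ≤ P.outlierPotential φ ν ε t :=
  (Real.exp_pos _).le

lemma noiseSum_succ (t : ℕ) :
    P.noiseSum φ ν ε (t + 1) =
      P.noiseSum φ ν ε t + P.noiseScore φ ν ε (t + 1) • P.scaled φ ν (t + 1) :=
  Finset.sum_range_succ _ _

lemma pastNorm_nonneg (hτ₀ : 0 < P.τ₀) (t : ℕ) : 0 ≤ P.pastNorm φ ν ε t :=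
  div_nonneg (matNorm_nonneg _ _) hτ₀.le

lemma leverage_le_one (hlam : 0 < P.lam) (t : ℕ) : P.leverage φ ν (t + 1) ≤ 1 := by
  have h := leverage_sq_eq (φ := φ) (ν := ν) hlam t
  have : 0 ≤ (1 + P.weight φ ν (t + 1) ^ 2)⁻¹ := by positivity
  exact (sq_le_one_iff₀ (leverage_nonneg _)).1 (by linarith)

lemma abs_noiseScore_mul_leverage_le (t : ℕ) :
    |P.noiseScore φ ν ε t| * (P.leverage φ ν t / P.τ₀) ≤ 1 := by
  rw [mul_comm]
  exact mul_abs_huberScore_le_one _ _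

lemma pastNorm_le (hlam : 0 < P.lam) (hτ₀ : 0 < P.τ₀) (t : ℕ) :
    P.pastNorm φ ν ε t ≤ matNorm (P.shape φ ν t)⁻¹ (P.noiseSum φ ν ε t) / P.τ₀ :=
  div_le_div_of_nonneg_right (matNorm_inv_shape_succ_le hlam t _) hτ₀.le

/-- The score is capped so that a round adds at most `τ₀` to the norm, and passing to a larger shape
matrix only decreases the inverse norm. This deterministic bound makes the potential bounded, hence
integrable. -/
lemma matNorm_noiseSum_div_le (hlam : 0 < P.lam) (hτ₀ : 0 < P.τ₀) (t : ℕ) :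
    matNorm (P.shape φ ν t)⁻¹ (P.noiseSum φ ν ε t) / P.τ₀ ≤ t := by
  induction t with
  | zero => simp [noiseSum, matNorm_zero]
  | succ t ih =>
    have h1 := matNorm_add_le (shape_posDef (φ := φ) (ν := ν) hlam (t + 1)).inv.posSemidef
      (P.noiseSum φ ν ε t) (P.noiseScore φ ν ε (t + 1) • P.scaled φ ν (t + 1))
    rw [← noiseSum_succ, matNorm_smul] at h1
    have h2 := div_le_div_of_nonneg_right h1 hτ₀.le
    rw [add_div, mul_div_assoc] at h2
    have h3 := (pastNorm_le (φ := φ) (ν := ν) (ε := ε) hlam hτ₀ t).trans ih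
    have h4 := abs_noiseScore_mul_leverage_le (φ := φ) (ν := ν) (ε := ε) (t + 1)
    rw [pastNorm] at h3
    rw [leverage] at h4
    push_cast
    linarith

lemma cosh_pastNorm_le (hlam : 0 < P.lam) (hτ₀ : 0 < P.τ₀) (t : ℕ) :
    Real.cosh (P.pastNorm φ ν ε t) ≤
      Real.cosh (matNorm (P.shape φ ν t)⁻¹ (P.noiseSum φ ν ε t) / P.τ₀) := by
  rw [Real.cosh_le_cosh, abs_of_nonneg (pastNorm_nonneg hτ₀ t),
    abs_of_nonneg (div_nonneg (matNorm_nonneg _ _) hτ₀.le)]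
  exact pastNorm_le hlam hτ₀ t

lemma cosh_noiseSum_le (hlam : 0 < P.lam) (hτ₀ : 0 < P.τ₀) (t : ℕ) :
    Real.cosh (matNorm (P.shape φ ν t)⁻¹ (P.noiseSum φ ν ε t) / P.τ₀) ≤ Real.cosh t := by
  rw [Real.cosh_le_cosh, abs_of_nonneg (div_nonneg (matNorm_nonneg _ _) hτ₀.le),
    abs_of_nonneg (Nat.cast_nonneg t)]
  exact matNorm_noiseSum_div_le hlam hτ₀ t

lemma abs_driftCoeff_le (hlam : 0 < P.lam) (hτ₀ : 0 < P.τ₀) (t : ℕ) :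
    |P.driftCoeff φ ν ε t| ≤
      Real.cosh (P.pastNorm φ ν ε t) * (P.leverage φ ν (t + 1) / P.τ₀) := by
  refine abs_sinh_div_mul_le (pastNorm_nonneg hτ₀ t) (div_nonneg (leverage_nonneg _) hτ₀.le) ?_
  rw [abs_div, abs_of_pos (pow_pos hτ₀ 2), pastNorm, leverage, div_mul_div_comm, ← sq]
  exact div_le_div_of_nonneg_right (abs_dotProduct_mulVec_le
    (shape_posDef (φ := φ) (ν := ν) hlam (t + 1)).inv.posSemidef _ _) (sq_nonneg _)

/-- One step of the recursion for the self-normalised noise. -/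
lemma cosh_noiseSum_succ_le (hlam : 0 < P.lam) (hτ₀ : 0 < P.τ₀) (t : ℕ) :
    Real.cosh (matNorm (P.shape φ ν (t + 1))⁻¹ (P.noiseSum φ ν ε (t + 1)) / P.τ₀) ≤
      Real.cosh (P.pastNorm φ ν ε t) +
      P.driftCoeff φ ν ε t * (ε (t + 1) / P.sigma φ ν (t + 1)) +
      3 / 2 * (P.leverage φ ν (t + 1) / P.τ₀) ^ 2 * Real.cosh (P.pastNorm φ ν ε t) *
        (ε (t + 1) / P.sigma φ ν (t + 1)) ^ 2 := by
  have hps := (shape_posDef (φ := φ) (ν := ν) hlam (t + 1)).inv.posSemidef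
  have hr := pastNorm_nonneg (φ := φ) (ν := ν) (ε := ε) hτ₀ t
  have hq : 0 ≤ P.leverage φ ν (t + 1) / P.τ₀ := div_nonneg (leverage_nonneg _) hτ₀.le
  have hone := abs_noiseScore_mul_leverage_le (φ := φ) (ν := ν) (ε := ε) (t + 1)
  have hA := abs_driftCoeff_le (φ := φ) (ν := ν) (ε := ε) hlam hτ₀ t
  have hdev := abs_huberScore_sub_le hq (ε (t + 1) / P.sigma φ ν (t + 1))
  have hsc := abs_huberScore_le (P.leverage φ ν (t + 1) / P.τ₀)
    (ε (t + 1) / P.sigma φ ν (t + 1))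
  change |P.noiseScore φ ν ε (t + 1)| ≤ _ at hsc
  change |P.noiseScore φ ν ε (t + 1) - _| ≤ _ at hdev
  set z := ε (t + 1) / P.sigma φ ν (t + 1)
  set m := (P.noiseSum φ ν ε t).ofLp ⬝ᵥ
    ((P.shape φ ν (t + 1))⁻¹ *ᵥ (P.scaled φ ν (t + 1)).ofLp) with hm
  have hmle := abs_dotProduct_mulVec_le hps (P.noiseSum φ ν ε t) (P.scaled φ ν (t + 1))
  rw [← hm] at hmle
  set η := P.noiseScore φ ν ε (t + 1)
  set q := P.leverage φ ν (t + 1) / P.τ₀ with hqdef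
  set r := P.pastNorm φ ν ε t with hrdef
  have hexp := quad_add hps (P.noiseSum φ ν ε t) (η • P.scaled φ ν (t + 1))
  rw [← noiseSum_succ, matNorm_smul, WithLp.ofLp_smul, Matrix.mulVec_smul, dotProduct_smul,
    ← hm] at hexp
  have hc : |η * (m / P.τ₀ ^ 2)| ≤ r * (|η| * q) := by
    rw [abs_mul, abs_div, abs_of_pos (pow_pos hτ₀ 2)]
    have : |m| / P.τ₀ ^ 2 ≤ r * q := by
      rw [hrdef, hqdef, pastNorm, leverage, div_mul_div_comm, ← sq]
      exact div_le_div_of_nonneg_right hmle (sq_nonneg _)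
    calc |η| * (|m| / P.τ₀ ^ 2) ≤ |η| * (r * q) := by gcongr
      _ = _ := by ring
  have hcosh := cosh_le_of_sq_eq
    (t := matNorm (P.shape φ ν (t + 1))⁻¹ (P.noiseSum φ ν ε (t + 1)) / P.τ₀)
    hr (mul_nonneg (abs_nonneg η) hq) hc (by
      rw [div_pow, hexp, hrdef, hqdef, pastNorm, leverage, smul_eq_mul]
      field_simp)
  have hsq := exp_sub_one_sub_id_le_sq (mul_nonneg (abs_nonneg η) hq) hone
  have hC : 0 < Real.cosh r := Real.cosh_pos r
  -- The cap `|η| q ≤ 1` permits `exp s - 1 - s ≤ s²`. This contributes `q² z²`; the bias of the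
  -- score in the next estimate contributes another half, giving the coefficient `3/2`.
  have h1 : Real.cosh r * (Real.exp (|η| * q) - 1 - |η| * q) ≤ Real.cosh r * (q ^ 2 * z ^ 2) := by
    refine mul_le_mul_of_nonneg_left (hsq.trans ?_) hC.le
    rw [mul_pow, mul_comm, sq_abs]
    exact mul_le_mul_of_nonneg_left (sq_le_sq.2 hsc) (sq_nonneg q)
  have h2 : Real.sinh r / r * (η * (m / P.τ₀ ^ 2)) ≤
      P.driftCoeff φ ν ε t * z + Real.cosh r * q * (q * z ^ 2 / 2) := by
    have e : Real.sinh r / r * (η * (m / P.τ₀ ^ 2)) =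
        P.driftCoeff φ ν ε t * z + P.driftCoeff φ ν ε t * (η - z) := by
      rw [driftCoeff]
      ring
    rw [e, add_le_add_iff_left]
    calc P.driftCoeff φ ν ε t * (η - z) ≤ |P.driftCoeff φ ν ε t| * |η - z| := by
          rw [← abs_mul]; exact le_abs_self _
      _ ≤ _ := by gcongr
  linarith

lemma largeNoise_nonneg (t : ℕ) : 0 ≤ P.largeNoise φ ν ε t := by
  unfold largeNoise; split_ifs <;> norm_num

lemma largeNoise_le_one (t : ℕ) : P.largeNoise φ ν ε t ≤ 1 := by
  unfold largeNoise; split_ifs <;> norm_num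

/-- Chebyshev pointwise: on the event, `2 q |z| > 1`. -/
lemma largeNoise_le (t : ℕ) :
    P.largeNoise φ ν ε t ≤
      4 * (P.leverage φ ν t / P.τ₀) ^ 2 * (ε t / P.sigma φ ν t) ^ 2 := by
  unfold largeNoise
  split_ifs with h
  · rw [← sq_abs (ε t / P.sigma φ ν t), mul_assoc, ← mul_pow]
    nlinarith
  · positivity

/-- Leverages are at most `c₀`, so the exponent of the round is at most the indicator and lies in
`[0, 1]`. There `exp s ≤ 1 + 2s`, and the bound `4 q² z²` on the indicator produces the constant 8.
-/
lemma outlierPotential_succ_le (hlam : 0 < P.lam) (hσ : 0 < P.sigmaMin) (hc : 0 < P.c₀) (t : ℕ) :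
    P.outlierPotential φ ν ε (t + 1) ≤
      P.outlierPotential φ ν ε t * Real.exp (-(8 * (P.leverage φ ν (t + 1) / P.τ₀) ^ 2)) *
        (1 + 8 * (P.leverage φ ν (t + 1) / P.τ₀) ^ 2 *
          (ε (t + 1) / P.sigma φ ν (t + 1)) ^ 2) := by
  have hp : P.leverage φ ν (t + 1) ^ 2 / P.c₀ ^ 2 ≤ 1 := by
    rw [div_le_one (by positivity)]
    exact pow_le_pow_left₀ (leverage_nonneg _)
      ((leverage_le_weight hlam t).trans (weight_le_c₀ hσ hc t)) 2
  have hp0 : 0 ≤ P.leverage φ ν (t + 1) ^ 2 / P.c₀ ^ 2 := by positivity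
  have hl := largeNoise_nonneg (φ := φ) (ν := ν) (ε := ε) (t + 1)
  have hl1 := largeNoise_le_one (φ := φ) (ν := ν) (ε := ε) (t + 1)
  have hl2 := largeNoise_le (φ := φ) (ν := ν) (ε := ε) (t + 1)
  have hx : P.leverage φ ν (t + 1) ^ 2 * P.largeNoise φ ν ε (t + 1) / P.c₀ ^ 2 ≤
      P.largeNoise φ ν ε (t + 1) := by
    rw [mul_div_right_comm]
    exact mul_le_of_le_one_left hl hp
  have hx0 : 0 ≤ P.leverage φ ν (t + 1) ^ 2 * P.largeNoise φ ν ε (t + 1) / P.c₀ ^ 2 := by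
    positivity
  have hexp := exp_le_one_add_two_mul hx0 (hx.trans hl1)
  rw [outlierPotential, Finset.sum_range_succ, Real.exp_add, ← outlierPotential, sub_eq_neg_add,
    Real.exp_add, mul_assoc]
  have h0 := outlierPotential_nonneg (P := P) (φ := φ) (ν := ν) (ε := ε) t
  gcongr
  linarith

end Potentials

lemma outlierPotential_le {P : AdaOFULParams} {φ : ℕ → Vec P.d} {ν ε : ℕ → ℝ}
    (hlam : 0 < P.lam) (hσ : 0 < P.sigmaMin) (hc : 0 < P.c₀) (t : ℕ) :
    P.outlierPotential φ ν ε t ≤ Real.exp t := by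
  refine Real.exp_le_exp.2 ?_
  calc _ ≤ ∑ s ∈ Finset.range t, (1 : ℝ) := Finset.sum_le_sum fun s _ => by
          have hp : P.leverage φ ν (s + 1) ^ 2 ≤ P.c₀ ^ 2 :=
            pow_le_pow_left₀ (leverage_nonneg _)
              ((leverage_le_weight hlam s).trans (weight_le_c₀ hσ hc s)) 2
          have h1 : P.leverage φ ν (s + 1) ^ 2 * P.largeNoise φ ν ε (s + 1) / P.c₀ ^ 2 ≤ 1 := by
            rw [div_le_one (by positivity)]
            exact (mul_le_of_le_one_right (sq_nonneg _) (largeNoise_le_one _)).trans hp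
          linarith [sq_nonneg (P.leverage φ ν (s + 1) / P.τ₀)]
    _ = t := by simp

lemma noisePotential_le {P : AdaOFULParams} {φ : ℕ → Vec P.d} {ν ε : ℕ → ℝ}
    (hlam : 0 < P.lam) (hτ₀ : 0 < P.τ₀) (t : ℕ) :
    P.noisePotential φ ν ε t ≤ Real.cosh t := by
  refine (mul_le_of_le_one_left (Real.cosh_pos _).le (Real.exp_le_one_iff.2 ?_)).trans
    (cosh_noiseSum_le hlam hτ₀ t)
  have : 0 ≤ ∑ s ∈ Finset.range t, (P.leverage φ ν (s + 1) / P.τ₀) ^ 2 := by positivity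
  linarith

/-! ### Adaptedness and integrability of the potentials. -/

section Integrals

variable {Ω : Type*} [mΩ : MeasurableSpace Ω] {μ : Measure Ω}
  {ℱ : Filtration ℕ mΩ} {P : AdaOFULParams} {D : ℕ → Set (Vec P.d)} {θs : Vec P.d}
  {φ : ℕ → Ω → Vec P.d} {ν y ε : ℕ → Ω → ℝ} {t : ℕ}

lemma feature_meas_le (hb : IsHeavyTailedBandit μ ℱ P.T P.L P.B D θs φ ν y ε) (ht : t < P.T) :
    ∀ s ≤ t, StronglyMeasurable[ℱ t] (φ (s + 1)) := fun s hs =>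
  (hb.feature_meas s (hs.trans_lt ht)).mono (ℱ.mono hs)

lemma std_meas_le (hb : IsHeavyTailedBandit μ ℱ P.T P.L P.B D θs φ ν y ε) (ht : t < P.T) :
    ∀ s ≤ t, StronglyMeasurable[ℱ t] (ν (s + 1)) := fun s hs =>
  (hb.std_meas s (hs.trans_lt ht)).mono (ℱ.mono hs)

lemma noise_meas_lt (hb : IsHeavyTailedBandit μ ℱ P.T P.L P.B D θs φ ν y ε) (ht : t ≤ P.T) :
    ∀ s < t, StronglyMeasurable[ℱ t] (ε (s + 1)) := fun s hs =>
  (hb.noise_meas s (hs.trans_le ht)).mono (ℱ.mono hs)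

lemma feature_meas_lt (hb : IsHeavyTailedBandit μ ℱ P.T P.L P.B D θs φ ν y ε) (ht : t ≤ P.T) :
    ∀ s < t, StronglyMeasurable[ℱ t] (φ (s + 1)) := fun s hs =>
  (hb.feature_meas s (hs.trans_le ht)).mono (ℱ.mono hs.le)

lemma std_meas_lt (hb : IsHeavyTailedBandit μ ℱ P.T P.L P.B D θs φ ν y ε) (ht : t ≤ P.T) :
    ∀ s < t, StronglyMeasurable[ℱ t] (ν (s + 1)) := fun s hs =>
  (hb.std_meas s (hs.trans_le ht)).mono (ℱ.mono hs.le)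

lemma stronglyMeasurable_noisePotential
    (hb : IsHeavyTailedBandit μ ℱ P.T P.L P.B D θs φ ν y ε) (ht : t ≤ P.T) :
    StronglyMeasurable[ℱ t] fun ω =>
      P.noisePotential (fun s => φ s ω) (fun s => ν s ω) (fun s => ε s ω) t := by
  have hφ := feature_meas_lt hb ht
  have hν := std_meas_lt hb ht
  have hN := StronglyMeasurable.matNorm (StronglyMeasurable.matrix_inv
    (stronglyMeasurable_shape hφ hν)) (stronglyMeasurable_noiseSum hφ hν (noise_meas_lt hb ht))
  have hlev : ∀ s ∈ Finset.range t, StronglyMeasurable[ℱ t] fun ω =>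
      (P.leverage (fun s => φ s ω) (fun s => ν s ω) (s + 1) / P.τ₀) ^ 2 := fun s hs => by
    have hs' := Finset.mem_range.1 hs
    exact (((stronglyMeasurable_leverage (fun r hr => hφ r (by omega))
      (fun r hr => hν r (by omega))).measurable.div_const _).pow_const 2).stronglyMeasurable
  have hsum := Finset.stronglyMeasurable_fun_sum _ hlev
  unfold noisePotential
  exact (Real.continuous_exp.comp_stronglyMeasurable (hsum.const_mul _)).mul
    (Real.continuous_cosh.comp_stronglyMeasurable
      (hN.measurable.div_const _).stronglyMeasurable)

lemma stronglyMeasurable_outlierPotential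
    (hb : IsHeavyTailedBandit μ ℱ P.T P.L P.B D θs φ ν y ε) (ht : t ≤ P.T) :
    StronglyMeasurable[ℱ t] fun ω =>
      P.outlierPotential (fun s => φ s ω) (fun s => ν s ω) (fun s => ε s ω) t := by
  have hφ := feature_meas_lt hb ht
  have hν := std_meas_lt hb ht
  have hε := noise_meas_lt hb ht
  unfold outlierPotential
  refine Real.continuous_exp.comp_stronglyMeasurable
    (Finset.stronglyMeasurable_fun_sum _ fun s hs => ?_)
  have hs' := Finset.mem_range.1 hs
  have hφs : ∀ r ≤ s, StronglyMeasurable[ℱ t] (φ (r + 1)) := fun r hr => hφ r (by omega)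
  have hνs : ∀ r ≤ s, StronglyMeasurable[ℱ t] (ν (r + 1)) := fun r hr => hν r (by omega)
  have hp := (stronglyMeasurable_leverage (P := P) hφs hνs).measurable
  have hl := (stronglyMeasurable_largeNoise (P := P) hφs hνs (hε s hs')).measurable
  exact (((hp.pow_const 2).mul hl).div_const _ |>.sub
    (((hp.div_const _).pow_const 2).const_mul _)).stronglyMeasurable

variable [IsProbabilityMeasure μ]

lemma integrable_noisePotential (hb : IsHeavyTailedBandit μ ℱ P.T P.L P.B D θs φ ν y ε)
    (hlam : 0 < P.lam) (hτ₀ : 0 < P.τ₀) (ht : t ≤ P.T) :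
    Integrable (fun ω =>
      P.noisePotential (fun s => φ s ω) (fun s => ν s ω) (fun s => ε s ω) t) μ := by
  refine Integrable.of_bound
    ((stronglyMeasurable_noisePotential hb ht).mono (ℱ.le t)).aestronglyMeasurable (Real.cosh t)
    (Filter.Eventually.of_forall fun ω => ?_)
  rw [Real.norm_of_nonneg (noisePotential_nonneg t)]
  exact noisePotential_le hlam hτ₀ t

lemma integrable_outlierPotential (hb : IsHeavyTailedBandit μ ℱ P.T P.L P.B D θs φ ν y ε)
    (hlam : 0 < P.lam) (hσ : 0 < P.sigmaMin) (hc : 0 < P.c₀) (ht : t ≤ P.T) :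
    Integrable (fun ω =>
      P.outlierPotential (fun s => φ s ω) (fun s => ν s ω) (fun s => ε s ω) t) μ := by
  refine Integrable.of_bound
    ((stronglyMeasurable_outlierPotential hb ht).mono (ℱ.le t)).aestronglyMeasurable (Real.exp t)
    (Filter.Eventually.of_forall fun ω => ?_)
  rw [Real.norm_of_nonneg (outlierPotential_nonneg t)]
  exact outlierPotential_le hlam hσ hc t

end Integrals

end AdaOFULParams

/-! ### The potentials do not grow in expectation. -/

namespace AdaOFULParams

lemma c₀_pos {P : AdaOFULParams} (hlog : 0 < Real.log (2 * (P.T : ℝ) ^ 2 / P.δ)) : 0 < P.c₀ := by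
  unfold c₀; positivity

lemma c₁_pos {P : AdaOFULParams} (hlog : 0 < Real.log (2 * (P.T : ℝ) ^ 2 / P.δ)) : 0 < P.c₁ := by
  unfold c₁; positivity

lemma c₀_sq {P : AdaOFULParams} (hlog : 0 < Real.log (2 * (P.T : ℝ) ^ 2 / P.δ)) :
    P.c₀ ^ 2 = 1 / (108 * Real.log (2 * (P.T : ℝ) ^ 2 / P.δ)) := by
  rw [c₀, div_pow, mul_pow, Real.sq_sqrt (by positivity)]
  ring_nf

variable {Ω : Type*} [mΩ : MeasurableSpace Ω] {μ : Measure Ω} [IsProbabilityMeasure μ]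
  {ℱ : Filtration ℕ mΩ} {P : AdaOFULParams} {D : ℕ → Set (Vec P.d)} {θs : Vec P.d}
  {φ : ℕ → Ω → Vec P.d} {ν y ε : ℕ → Ω → ℝ} {t : ℕ}

/-- The one-step bound is quadratic in the new noise with coefficients known beforehand. The linear
term averages to zero, the variance is at most `σ²`, and the compensator absorbs the rest through `1
+ x ≤ exp x` with `x = 3/2 q²`. -/
lemma integral_noisePotential_succ_le
    (hb : IsHeavyTailedBandit μ ℱ P.T P.L P.B D θs φ ν y ε) (hlam : 0 < P.lam)
    (hσ : 0 < P.sigmaMin) (hτ₀ : 0 < P.τ₀) (ht : t < P.T) :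
    ∫ ω, P.noisePotential (fun s => φ s ω) (fun s => ν s ω) (fun s => ε s ω) (t + 1) ∂μ ≤
      ∫ ω, P.noisePotential (fun s => φ s ω) (fun s => ν s ω) (fun s => ε s ω) t ∂μ := by
  have hφ := feature_meas_le hb ht
  have hν := std_meas_le hb ht
  have hlev : ∀ s ≤ t, Measurable[ℱ t] fun ω =>
      P.leverage (fun s => φ s ω) (fun s => ν s ω) (s + 1) / P.τ₀ := fun s hs =>
    (stronglyMeasurable_leverage (fun r hr => hφ r (hr.trans hs))
      (fun r hr => hν r (hr.trans hs))).measurable.div_const _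
  have hinv : StronglyMeasurable[ℱ t] fun ω =>
      (P.shape (fun s => φ s ω) (fun s => ν s ω) (t + 1))⁻¹ :=
    StronglyMeasurable.matrix_inv (stronglyMeasurable_shape (fun s hs => hφ s (by omega))
      (fun s hs => hν s (by omega)))
  have hS : StronglyMeasurable[ℱ t] fun ω =>
      P.noiseSum (fun s => φ s ω) (fun s => ν s ω) (fun s => ε s ω) t :=
    stronglyMeasurable_noiseSum (feature_meas_lt hb ht.le) (std_meas_lt hb ht.le)
      (noise_meas_lt hb ht.le)
  have hr : Measurable[ℱ t] fun ω =>
      P.pastNorm (fun s => φ s ω) (fun s => ν s ω) (fun s => ε s ω) t :=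
    (StronglyMeasurable.matNorm hinv hS).measurable.div_const _
  have hA : Measurable[ℱ t] fun ω =>
      P.driftCoeff (fun s => φ s ω) (fun s => ν s ω) (fun s => ε s ω) t :=
    ((Real.measurable_sinh.comp hr).div hr).mul
      ((StronglyMeasurable.dotProduct_mulVec hinv hS
        (stronglyMeasurable_scaled hφ hν)).measurable.div_const _)
  have hsig : Measurable[ℱ t] fun ω =>
      P.sigma (fun s => φ s ω) (fun s => ν s ω) (t + 1) :=
    (stronglyMeasurable_sigma hφ hν).measurable
  have hsum : Measurable[ℱ t] fun ω => ∑ s ∈ Finset.range (t + 1),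
      (P.leverage (fun s => φ s ω) (fun s => ν s ω) (s + 1) / P.τ₀) ^ 2 :=
    Finset.measurable_fun_sum _ fun s hs =>
      (hlev s (Nat.lt_succ_iff.1 (Finset.mem_range.1 hs))).pow_const 2
  have hW : Measurable[ℱ t] fun ω => Real.exp (-(3 / 2) * ∑ s ∈ Finset.range (t + 1),
      (P.leverage (fun s => φ s ω) (fun s => ν s ω) (s + 1) / P.τ₀) ^ 2) :=
    Real.measurable_exp.comp (hsum.const_mul _)
  have hC : Measurable[ℱ t] fun ω =>
      Real.cosh (P.pastNorm (fun s => φ s ω) (fun s => ν s ω) (fun s => ε s ω) t) :=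
    Real.measurable_cosh.comp hr
  have hW1 : ∀ ω, Real.exp (-(3 / 2) * ∑ s ∈ Finset.range (t + 1),
      (P.leverage (fun s => φ s ω) (fun s => ν s ω) (s + 1) / P.τ₀) ^ 2) ≤ 1 := fun ω => by
    refine Real.exp_le_one_iff.2 ?_
    have : 0 ≤ ∑ s ∈ Finset.range (t + 1),
      (P.leverage (fun s => φ s ω) (fun s => ν s ω) (s + 1) / P.τ₀) ^ 2 := by positivity
    linarith
  have hCt : ∀ ω, Real.cosh (P.pastNorm (fun s => φ s ω) (fun s => ν s ω) (fun s => ε s ω) t) ≤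
      Real.cosh t := fun ω => (cosh_pastNorm_le hlam hτ₀ t).trans (cosh_noiseSum_le hlam hτ₀ t)
  have hq1 : ∀ ω, P.leverage (fun s => φ s ω) (fun s => ν s ω) (t + 1) / P.τ₀ ≤ 1 / P.τ₀ :=
    fun ω => div_le_div_of_nonneg_right (leverage_le_one hlam t) hτ₀.le
  have hq0 : ∀ ω, 0 ≤ P.leverage (fun s => φ s ω) (fun s => ν s ω) (t + 1) / P.τ₀ :=
    fun ω => div_nonneg (leverage_nonneg _) hτ₀.le
  have hsm : ∀ ω, P.sigmaMin ≤ P.sigma (fun s => φ s ω) (fun s => ν s ω) (t + 1) :=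
    fun ω => sigmaMin_le_sigma _
  -- The constant `K` is the sum of the bounds on the two coefficients, since it has to serve both.
  refine integral_le_of_le_quadratic (ℱ.le t)
    (K := Real.cosh t * (1 / P.τ₀) / P.sigmaMin +
      3 / 2 * (1 / P.τ₀) ^ 2 * Real.cosh t / P.sigmaMin ^ 2)
    (a := fun ω => Real.exp (-(3 / 2) * ∑ s ∈ Finset.range (t + 1),
      (P.leverage (fun s => φ s ω) (fun s => ν s ω) (s + 1) / P.τ₀) ^ 2) *
        Real.cosh (P.pastNorm (fun s => φ s ω) (fun s => ν s ω) (fun s => ε s ω) t))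
    (b := fun ω => Real.exp (-(3 / 2) * ∑ s ∈ Finset.range (t + 1),
      (P.leverage (fun s => φ s ω) (fun s => ν s ω) (s + 1) / P.τ₀) ^ 2) *
        (P.driftCoeff (fun s => φ s ω) (fun s => ν s ω) (fun s => ε s ω) t /
          P.sigma (fun s => φ s ω) (fun s => ν s ω) (t + 1)))
    (c := fun ω => Real.exp (-(3 / 2) * ∑ s ∈ Finset.range (t + 1),
      (P.leverage (fun s => φ s ω) (fun s => ν s ω) (s + 1) / P.τ₀) ^ 2) *
        (3 / 2 * (P.leverage (fun s => φ s ω) (fun s => ν s ω) (t + 1) / P.τ₀) ^ 2 *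
          Real.cosh (P.pastNorm (fun s => φ s ω) (fun s => ν s ω) (fun s => ε s ω) t) /
          P.sigma (fun s => φ s ω) (fun s => ν s ω) (t + 1) ^ 2))
    (hW.mul (hA.div hsig)).stronglyMeasurable ?_
    (hW.mul (((((hlev t le_rfl).pow_const 2).const_mul _).mul hC).div
      (hsig.pow_const 2))).stronglyMeasurable ?_ ?_
    (integrable_noisePotential hb hlam hτ₀ ht.le)
    (integrable_noisePotential hb hlam hτ₀ (Nat.succ_le_of_lt ht)) (hb.noise_sq_integrable t ht)
    (hb.noise_mean t ht) (hb.noise_var t ht) ?_ ?_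
  · intro ω
    have h2 : 0 ≤ 3 / 2 * (1 / P.τ₀) ^ 2 * Real.cosh t / P.sigmaMin ^ 2 := by
      have := Real.cosh_pos (t : ℝ)
      positivity
    have hσt : 0 < P.sigma (fun s => φ s ω) (fun s => ν s ω) (t + 1) := hσ.trans_le (hsm ω)
    rw [abs_mul, abs_of_pos (Real.exp_pos _), abs_div, abs_of_pos hσt]
    refine (mul_le_of_le_one_left (by positivity) (hW1 ω)).trans ?_
    refine le_trans ?_ (le_add_of_nonneg_right h2)
    refine div_le_div₀ (by have := Real.cosh_pos (t : ℝ); positivity)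
      ((abs_driftCoeff_le hlam hτ₀ t).trans ?_) hσ (hsm ω)
    exact mul_le_mul (hCt ω) (hq1 ω) (hq0 ω) (Real.cosh_pos _).le
  · intro ω
    have h2 : 0 ≤ Real.cosh t * (1 / P.τ₀) / P.sigmaMin := by
      have := Real.cosh_pos (t : ℝ)
      positivity
    have hσt : 0 < P.sigma (fun s => φ s ω) (fun s => ν s ω) (t + 1) := hσ.trans_le (hsm ω)
    have hCp := Real.cosh_pos (P.pastNorm (fun s => φ s ω) (fun s => ν s ω) (fun s => ε s ω) t)
    rw [abs_of_nonneg (by positivity)]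
    refine (mul_le_of_le_one_left (by positivity) (hW1 ω)).trans ?_
    refine le_trans ?_ (le_add_of_nonneg_left h2)
    have hct := hCt ω
    have hq1' := hq1 ω
    have hq0' := hq0 ω
    have hsm' := hsm ω
    gcongr
  · refine Integrable.of_bound ((hW.mul hC).mono (ℱ.le t) le_rfl).aestronglyMeasurable (Real.cosh t)
      (Filter.Eventually.of_forall fun ω => ?_)
    rw [Real.norm_of_nonneg (mul_pos (Real.exp_pos _) (Real.cosh_pos _)).le]
    exact (mul_le_of_le_one_left (Real.cosh_pos _).le (hW1 ω)).trans (hCt ω)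
  · intro ω
    have h := mul_le_mul_of_nonneg_left
      (cosh_noiseSum_succ_le (φ := fun s => φ s ω) (ν := fun s => ν s ω) (ε := fun s => ε s ω)
        hlam hτ₀ t)
      (Real.exp_pos (-(3 / 2) * ∑ s ∈ Finset.range (t + 1),
        (P.leverage (fun s => φ s ω) (fun s => ν s ω) (s + 1) / P.τ₀) ^ 2)).le
    refine h.trans_eq ?_
    ring
  · intro ω
    have hσt : 0 < P.sigma (fun s => φ s ω) (fun s => ν s ω) (t + 1) := hσ.trans_le (hsm ω)
    have hCp := Real.cosh_pos (P.pastNorm (fun s => φ s ω) (fun s => ν s ω) (fun s => ε s ω) t)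
    have hratio : ν (t + 1) ω ^ 2 / P.sigma (fun s => φ s ω) (fun s => ν s ω) (t + 1) ^ 2 ≤ 1 := by
      rw [div_le_one (by positivity)]
      exact pow_le_pow_left₀ (hb.std_nonneg t ht ω)
        (std_le_sigma (φ := fun s => φ s ω) (ν := fun s => ν s ω) (t + 1)) 2
    have hle := cosh_pastNorm_le (φ := fun s => φ s ω) (ν := fun s => ν s ω)
      (ε := fun s => ε s ω) hlam hτ₀ t
    rw [Finset.sum_range_succ, mul_add, Real.exp_add]
    set q := P.leverage (fun s => φ s ω) (fun s => ν s ω) (t + 1) / P.τ₀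
    set C := Real.cosh (P.pastNorm (fun s => φ s ω) (fun s => ν s ω) (fun s => ε s ω) t)
    set W := Real.exp (-(3 / 2) * ∑ s ∈ Finset.range t,
        (P.leverage (fun s => φ s ω) (fun s => ν s ω) (s + 1) / P.τ₀) ^ 2) with hWdef
    have hW0 : 0 < W := Real.exp_pos _
    have hE : Real.exp (-(3 / 2) * q ^ 2) * (1 + 3 / 2 * q ^ 2) ≤ 1 := by
      have h1 := Real.add_one_le_exp (3 / 2 * q ^ 2)
      calc _ ≤ Real.exp (-(3 / 2) * q ^ 2) * Real.exp (3 / 2 * q ^ 2) := by gcongr; linarith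
        _ = 1 := by rw [← Real.exp_add]; simp
    calc W * Real.exp (-(3 / 2) * q ^ 2) * C + W * Real.exp (-(3 / 2) * q ^ 2) *
          (3 / 2 * q ^ 2 * C / P.sigma (fun s => φ s ω) (fun s => ν s ω) (t + 1) ^ 2) *
            ν (t + 1) ω ^ 2
        = W * C * Real.exp (-(3 / 2) * q ^ 2) * (1 + 3 / 2 * q ^ 2 * (ν (t + 1) ω ^ 2 /
            P.sigma (fun s => φ s ω) (fun s => ν s ω) (t + 1) ^ 2)) := by ring
      _ ≤ W * C * Real.exp (-(3 / 2) * q ^ 2) * (1 + 3 / 2 * q ^ 2 * 1) := by gcongr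
      _ = W * C * (Real.exp (-(3 / 2) * q ^ 2) * (1 + 3 / 2 * q ^ 2)) := by ring
      _ ≤ W * C * 1 := by gcongr
      _ ≤ _ := by rw [mul_one]; exact mul_le_mul_of_nonneg_left hle hW0.le

/-- The mechanism is that of the noise potential, without linear term and with compensator `8 q²`.
-/
lemma integral_outlierPotential_succ_le
    (hb : IsHeavyTailedBandit μ ℱ P.T P.L P.B D θs φ ν y ε) (hlam : 0 < P.lam)
    (hσ : 0 < P.sigmaMin) (hc : 0 < P.c₀) (hτ₀ : 0 < P.τ₀) (ht : t < P.T) :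
    ∫ ω, P.outlierPotential (fun s => φ s ω) (fun s => ν s ω) (fun s => ε s ω) (t + 1) ∂μ ≤
      ∫ ω, P.outlierPotential (fun s => φ s ω) (fun s => ν s ω) (fun s => ε s ω) t ∂μ := by
  have hφ := feature_meas_le hb ht
  have hν := std_meas_le hb ht
  have hlev : Measurable[ℱ t] fun ω =>
      P.leverage (fun s => φ s ω) (fun s => ν s ω) (t + 1) / P.τ₀ :=
    (stronglyMeasurable_leverage hφ hν).measurable.div_const _
  have hsig : Measurable[ℱ t] fun ω =>
      P.sigma (fun s => φ s ω) (fun s => ν s ω) (t + 1) :=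
    (stronglyMeasurable_sigma hφ hν).measurable
  have hV : Measurable[ℱ t] fun ω =>
      P.outlierPotential (fun s => φ s ω) (fun s => ν s ω) (fun s => ε s ω) t :=
    (stronglyMeasurable_outlierPotential hb ht.le).measurable
  have ha : Measurable[ℱ t] fun ω =>
      P.outlierPotential (fun s => φ s ω) (fun s => ν s ω) (fun s => ε s ω) t *
        Real.exp (-(8 * (P.leverage (fun s => φ s ω) (fun s => ν s ω) (t + 1) / P.τ₀) ^ 2)) :=
    hV.mul (Real.measurable_exp.comp ((hlev.pow_const 2).const_mul 8).neg)
  have ha0 : ∀ ω, 0 ≤ P.outlierPotential (fun s => φ s ω) (fun s => ν s ω) (fun s => ε s ω) t *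
      Real.exp (-(8 * (P.leverage (fun s => φ s ω) (fun s => ν s ω) (t + 1) / P.τ₀) ^ 2)) :=
    fun ω => mul_nonneg (outlierPotential_nonneg t) (Real.exp_pos _).le
  have haK : ∀ ω, P.outlierPotential (fun s => φ s ω) (fun s => ν s ω) (fun s => ε s ω) t *
      Real.exp (-(8 * (P.leverage (fun s => φ s ω) (fun s => ν s ω) (t + 1) / P.τ₀) ^ 2)) ≤
        Real.exp t := fun ω =>
    (mul_le_of_le_one_right (outlierPotential_nonneg t) (Real.exp_le_one_iff.2
      (neg_nonpos.2 (by positivity)))).trans (outlierPotential_le hlam hσ hc t)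
  have hsm : ∀ ω, P.sigmaMin ≤ P.sigma (fun s => φ s ω) (fun s => ν s ω) (t + 1) :=
    fun ω => sigmaMin_le_sigma _
  refine integral_le_of_le_quadratic (ℱ.le t)
    (K := Real.exp t * (8 * (1 / P.τ₀) ^ 2 / P.sigmaMin ^ 2))
    (a := fun ω => P.outlierPotential (fun s => φ s ω) (fun s => ν s ω) (fun s => ε s ω) t *
      Real.exp (-(8 * (P.leverage (fun s => φ s ω) (fun s => ν s ω) (t + 1) / P.τ₀) ^ 2)))
    (b := fun _ => 0)
    (c := fun ω => P.outlierPotential (fun s => φ s ω) (fun s => ν s ω) (fun s => ε s ω) t *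
      Real.exp (-(8 * (P.leverage (fun s => φ s ω) (fun s => ν s ω) (t + 1) / P.τ₀) ^ 2)) *
        (8 * (P.leverage (fun s => φ s ω) (fun s => ν s ω) (t + 1) / P.τ₀) ^ 2 /
          P.sigma (fun s => φ s ω) (fun s => ν s ω) (t + 1) ^ 2))
    stronglyMeasurable_const ?_
    (ha.mul (((hlev.pow_const 2).const_mul 8).div (hsig.pow_const 2))).stronglyMeasurable ?_ ?_
    (integrable_outlierPotential hb hlam hσ hc ht.le)
    (integrable_outlierPotential hb hlam hσ hc (Nat.succ_le_of_lt ht))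
    (hb.noise_sq_integrable t ht) (hb.noise_mean t ht) (hb.noise_var t ht) ?_ ?_
  · intro ω
    rw [abs_zero]
    positivity
  · intro ω
    have hσt : 0 < P.sigma (fun s => φ s ω) (fun s => ν s ω) (t + 1) := hσ.trans_le (hsm ω)
    rw [abs_of_nonneg (mul_nonneg (ha0 ω) (by positivity))]
    have hq1 : P.leverage (fun s => φ s ω) (fun s => ν s ω) (t + 1) / P.τ₀ ≤ 1 / P.τ₀ :=
      div_le_div_of_nonneg_right (leverage_le_one hlam t) hτ₀.le
    have hq0 : 0 ≤ P.leverage (fun s => φ s ω) (fun s => ν s ω) (t + 1) / P.τ₀ :=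
      div_nonneg (leverage_nonneg _) hτ₀.le
    have hsm' := hsm ω
    refine mul_le_mul (haK ω) ?_ (by positivity) (Real.exp_pos _).le
    gcongr
  · refine Integrable.of_bound (ha.mono (ℱ.le t) le_rfl).aestronglyMeasurable (Real.exp t)
      (Filter.Eventually.of_forall fun ω => ?_)
    rw [Real.norm_of_nonneg (ha0 ω)]
    exact haK ω
  · intro ω
    refine (outlierPotential_succ_le hlam hσ hc t).trans_eq ?_
    ring
  · intro ω
    have hσt : 0 < P.sigma (fun s => φ s ω) (fun s => ν s ω) (t + 1) := hσ.trans_le (hsm ω)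
    have hratio : ν (t + 1) ω ^ 2 / P.sigma (fun s => φ s ω) (fun s => ν s ω) (t + 1) ^ 2 ≤ 1 := by
      rw [div_le_one (by positivity)]
      exact pow_le_pow_left₀ (hb.std_nonneg t ht ω)
        (std_le_sigma (φ := fun s => φ s ω) (ν := fun s => ν s ω) (t + 1)) 2
    have hV0 := outlierPotential_nonneg (P := P) (φ := fun s => φ s ω) (ν := fun s => ν s ω)
      (ε := fun s => ε s ω) t
    set q := P.leverage (fun s => φ s ω) (fun s => ν s ω) (t + 1) / P.τ₀
    set V := P.outlierPotential (fun s => φ s ω) (fun s => ν s ω) (fun s => ε s ω) t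
    have hE : Real.exp (-(8 * q ^ 2)) * (1 + 8 * q ^ 2) ≤ 1 := by
      have h1 := Real.add_one_le_exp (8 * q ^ 2)
      calc _ ≤ Real.exp (-(8 * q ^ 2)) * Real.exp (8 * q ^ 2) := by gcongr; linarith
        _ = 1 := by rw [← Real.exp_add]; simp
    calc V * Real.exp (-(8 * q ^ 2)) + V * Real.exp (-(8 * q ^ 2)) *
          (8 * q ^ 2 / P.sigma (fun s => φ s ω) (fun s => ν s ω) (t + 1) ^ 2) * ν (t + 1) ω ^ 2
        = V * Real.exp (-(8 * q ^ 2)) * (1 + 8 * q ^ 2 * (ν (t + 1) ω ^ 2 /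
            P.sigma (fun s => φ s ω) (fun s => ν s ω) (t + 1) ^ 2)) := by ring
      _ ≤ V * Real.exp (-(8 * q ^ 2)) * (1 + 8 * q ^ 2 * 1) := by gcongr
      _ = V * (Real.exp (-(8 * q ^ 2)) * (1 + 8 * q ^ 2)) := by ring
      _ ≤ V * 1 := by gcongr
      _ = V := mul_one V

lemma integral_noisePotential_le_one
    (hb : IsHeavyTailedBandit μ ℱ P.T P.L P.B D θs φ ν y ε) (hlam : 0 < P.lam)
    (hσ : 0 < P.sigmaMin) (hτ₀ : 0 < P.τ₀) (ht : t ≤ P.T) :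
    ∫ ω, P.noisePotential (fun s => φ s ω) (fun s => ν s ω) (fun s => ε s ω) t ∂μ ≤ 1 := by
  induction t with
  | zero => simp [noisePotential, noiseSum, matNorm_zero]
  | succ t ih =>
    exact (integral_noisePotential_succ_le hb hlam hσ hτ₀ ht).trans (ih (Nat.le_of_succ_le ht))

lemma integral_outlierPotential_le_one
    (hb : IsHeavyTailedBandit μ ℱ P.T P.L P.B D θs φ ν y ε) (hlam : 0 < P.lam)
    (hσ : 0 < P.sigmaMin) (hc : 0 < P.c₀) (hτ₀ : 0 < P.τ₀) (ht : t ≤ P.T) :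
    ∫ ω, P.outlierPotential (fun s => φ s ω) (fun s => ν s ω) (fun s => ε s ω) t ∂μ ≤ 1 := by
  induction t with
  | zero => simp [outlierPotential]
  | succ t ih =>
    exact (integral_outlierPotential_succ_le hb hlam hσ hc hτ₀ ht).trans
      (ih (Nat.le_of_succ_le ht))

end AdaOFULParams

/-! ### Markov's inequality and numerical estimates. -/

lemma measure_inv_le_of_integral_le_one {Ω : Type*} [mΩ : MeasurableSpace Ω] {μ : Measure Ω}
    [IsProbabilityMeasure μ] {f : Ω → ℝ} (hf : Integrable f μ) (h0 : ∀ ω, 0 ≤ f ω)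
    (h1 : ∫ ω, f ω ∂μ ≤ 1) {c : ℝ} (hc : 0 < c) :
    μ {ω | c⁻¹ ≤ f ω} ≤ ENNReal.ofReal c := by
  have h := mul_meas_ge_le_integral_of_nonneg (Filter.Eventually.of_forall h0) hf c⁻¹
  rw [← ENNReal.ofReal_toReal (measure_ne_top μ {ω | c⁻¹ ≤ f ω})]
  refine ENNReal.ofReal_le_ofReal ?_
  have h2 := h.trans h1
  rwa [inv_mul_le_iff₀ hc, mul_one] at h2

lemma sum_inv_succ_sq_le (n : ℕ) : ∑ t ∈ Finset.range n, (1 : ℝ) / ((t : ℝ) + 1) ^ 2 ≤ 2 := by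
  -- The sharper bound with a remainder is what telescopes under induction.
  have h : ∑ t ∈ Finset.range (n + 1), (1 : ℝ) / ((t : ℝ) + 1) ^ 2 ≤ 2 - 1 / ((n : ℝ) + 1) := by
    induction n with
    | zero => norm_num
    | succ n ih =>
      rw [Finset.sum_range_succ]
      have h1 : (1 : ℝ) / ((n : ℝ) + 1 + 1) ^ 2 ≤ 1 / ((n : ℝ) + 1) - 1 / ((n : ℝ) + 1 + 1) := by
        rw [div_sub_div _ _ (by positivity) (by positivity)]
        refine div_le_div₀ (by linarith) (by linarith) (by positivity) ?_
        nlinarith [(Nat.cast_nonneg n : (0 : ℝ) ≤ n)]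
      push_cast
      linarith
  rw [Finset.sum_range_succ] at h
  have h1 : (0 : ℝ) ≤ 1 / ((n : ℝ) + 1) ^ 2 := by positivity
  have h2 : (0 : ℝ) ≤ 1 / ((n : ℝ) + 1) := by positivity
  linarith

lemma log_two_mul_sq_div_pos {δ : ℝ} (hδ : 0 < δ) (hδ1 : δ < 1) {n : ℕ} (hn : 0 < n) :
    0 < Real.log (2 * (n : ℝ) ^ 2 / δ) := by
  refine Real.log_pos ((one_lt_div hδ).2 ?_)
  have : (1 : ℝ) ≤ (n : ℝ) ^ 2 := one_le_pow₀ (by exact_mod_cast hn)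
  linarith

/-! ### From small potentials to the confidence sets. -/

namespace AdaOFULParams

variable {P : AdaOFULParams} {φ : ℕ → Vec P.d} {ν ε : ℕ → ℝ}

lemma sum_leverage_div_sq_le (hd : 0 < P.d) (hlam : 0 < P.lam) (hσ : 0 < P.sigmaMin)
    (hφ : ∀ t < P.T, ‖φ (t + 1)‖ ≤ P.L) {t : ℕ} (ht : t ≤ P.T) :
    ∑ s ∈ Finset.range t, (P.leverage φ ν (s + 1) / P.τ₀) ^ 2 ≤ P.kappa / P.τ₀ ^ 2 := by
  simp_rw [div_pow]
  rw [← Finset.sum_div]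
  exact div_le_div_of_nonneg_right (sum_leverage_sq_le hd hlam hσ hφ ht) (sq_nonneg _)

lemma noise_le_of_noisePotential_lt (hd : 0 < P.d) (hlam : 0 < P.lam) (hσ : 0 < P.sigmaMin)
    (hτ₀ : 0 < P.τ₀) (hφ : ∀ t < P.T, ‖φ (t + 1)‖ ≤ P.L) {t : ℕ} (ht : t ≤ P.T) {M : ℝ}
    (hM : 0 < M) (h : P.noisePotential φ ν ε t < M) :
    matNorm (P.shape φ ν t)⁻¹ (P.noiseSum φ ν ε t) ≤
      3 / 2 * (P.kappa / P.τ₀) + P.τ₀ * Real.log (2 * M) := by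
  have hsum := sum_leverage_div_sq_le (ν := ν) hd hlam hσ hφ ht
  set N := matNorm (P.shape φ ν t)⁻¹ (P.noiseSum φ ν ε t)
  -- Dropping the decaying exponential costs the factor 2 in `log (2 * M)`.
  have h1 : Real.exp (N / P.τ₀) / 2 ≤ Real.cosh (N / P.τ₀) := by
    rw [Real.cosh_eq]
    have := Real.exp_pos (-(N / P.τ₀))
    linarith
  have h2 : Real.exp (-(3 / 2) * (P.kappa / P.τ₀ ^ 2)) * (Real.exp (N / P.τ₀) / 2) < M := by
    refine lt_of_le_of_lt ?_ h
    refine mul_le_mul (Real.exp_le_exp.2 (by linarith)) h1 (by positivity) (Real.exp_pos _).le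
  have h3 : Real.exp (-(3 / 2) * (P.kappa / P.τ₀ ^ 2) + N / P.τ₀) < 2 * M := by
    rw [Real.exp_add]
    linarith
  rw [← Real.lt_log_iff_exp_lt (by positivity)] at h3
  have h4 : N / P.τ₀ ≤ 3 / 2 * (P.kappa / P.τ₀ ^ 2) + Real.log (2 * M) := by linarith
  rw [div_le_iff₀ hτ₀] at h4
  refine h4.trans_eq ?_
  field_simp

lemma sum_outlier_le_of_outlierPotential_lt (hd : 0 < P.d) (hlam : 0 < P.lam)
    (hσ : 0 < P.sigmaMin) (hτ₀ : 0 < P.τ₀) (hφ : ∀ t < P.T, ‖φ (t + 1)‖ ≤ P.L)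
    (hδ : 0 < P.δ) (hlog : 0 < Real.log (2 * (P.T : ℝ) ^ 2 / P.δ))
    (hlogδ : Real.log P.δ⁻¹ ≤ Real.log (2 * (P.T : ℝ) ^ 2 / P.δ))
    (hκ : 2 * P.kappa ≤ P.τ₀ ^ 2 * Real.log (2 * (P.T : ℝ) ^ 2 / P.δ))
    (h : P.outlierPotential φ ν ε P.T < P.δ⁻¹) {t : ℕ} (ht : t ≤ P.T) :
    ∑ s ∈ Finset.range t,
      P.leverage φ ν (s + 1) ^ 2 * P.largeNoise φ ν ε (s + 1) ≤ 1 / 20 := by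
  have hc := c₀_pos hlog
  have hsum := sum_leverage_div_sq_le (ν := ν) hd hlam hσ hφ le_rfl
  refine (Finset.sum_le_sum_of_subset_of_nonneg (Finset.range_mono ht)
    fun s _ _ => mul_nonneg (sq_nonneg _) (largeNoise_nonneg _)).trans ?_
  rw [outlierPotential, ← Real.lt_log_iff_exp_lt (by positivity), Finset.sum_sub_distrib,
    ← Finset.sum_div, ← Finset.mul_sum] at h
  set ℓ := Real.log (2 * (P.T : ℝ) ^ 2 / P.δ)
  have hκ' : P.kappa / P.τ₀ ^ 2 ≤ ℓ / 2 := by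
    rw [div_le_iff₀ (by positivity)]
    linarith
  -- The 5 is 1 from `log (1 / δ) ≤ ℓ` plus `8 · 1/2` from the compensator. Multiplying by `c₀² = 1
  -- / (108 ℓ)` leaves `5/108 < 1/20`.
  have h2 : (∑ s ∈ Finset.range P.T,
      P.leverage φ ν (s + 1) ^ 2 * P.largeNoise φ ν ε (s + 1)) / P.c₀ ^ 2 ≤ 5 * ℓ := by
    linarith
  rw [div_le_iff₀ (by positivity), c₀_sq hlog] at h2
  refine h2.trans ?_
  have e : 5 * ℓ * (1 / (108 * ℓ)) = 5 / 108 := by field_simp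
  rw [e]
  norm_num

/-- The shift is at most `2LB / σ` and the leverage at most `w`, so `LB w ≤ σ √(c₁ d)` reduces
everything to `√(c₁ d) ≤ τ₀ / 4`. -/
lemma leverage_mul_shift_le (hd : 0 < P.d) (hlam : 0 < P.lam)
    (hσ : 0 < P.sigmaMin) (hτ₀ : 0 < P.τ₀)
    (hlog : 0 < Real.log (2 * (P.T : ℝ) ^ 2 / P.δ))
    (hκ : 2 * P.kappa ≤ P.τ₀ ^ 2 * Real.log (2 * (P.T : ℝ) ^ 2 / P.δ))
    (hdκ : (P.d : ℝ) ≤ 2 * P.kappa) (hL : 0 ≤ P.L) (hB : 0 ≤ P.B) {t : ℕ}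
    (hφ : ‖φ (t + 1)‖ ≤ P.L) {x z : Vec P.d} (hx : ‖x‖ ≤ P.B) (hz : ‖z‖ ≤ P.B) :
    P.leverage φ ν (t + 1) / P.τ₀ * |⟪P.scaled φ ν (t + 1), x - z⟫| ≤ 1 / 2 := by
  have hσt : 0 < P.sigma φ ν (t + 1) := hσ.trans_le (sigmaMin_le_sigma _)
  have hin : |⟪P.scaled φ ν (t + 1), x - z⟫| ≤ 2 * (P.L * P.B) / P.sigma φ ν (t + 1) := by
    rw [scaled, real_inner_smul_left, abs_mul, abs_of_pos (inv_pos.2 hσt), inv_mul_eq_div]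
    refine div_le_div_of_nonneg_right ((abs_real_inner_le_norm _ _).trans ?_) hσt.le
    have h2 : ‖x - z‖ ≤ 2 * P.B := (norm_sub_le _ _).trans (by linarith)
    calc ‖φ (t + 1)‖ * ‖x - z‖ ≤ P.L * (2 * P.B) := by gcongr
      _ = _ := by ring
  have hw := mul_weight_le_sigma (φ := φ) (ν := ν) hd hσ (c₁_pos hlog) (mul_nonneg hL hB) t
  have hlw := leverage_le_weight (φ := φ) (ν := ν) hlam t
  have hsqrt : Real.sqrt (P.c₁ * P.d) ≤ P.τ₀ / 4 := by
    refine Real.sqrt_le_iff.2 ⟨by positivity, ?_⟩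
    rw [c₁, div_mul_eq_mul_div, div_le_iff₀ (by positivity)]
    -- `d ≤ 2κ ≤ τ₀² ℓ`, hence `c₁ d ≤ τ₀² / 42 ≤ τ₀² / 16`.
    nlinarith
  have hlev := leverage_nonneg (P := P) (φ := φ) (ν := ν) (t + 1)
  have hw0 := weight_nonneg (P := P) (φ := φ) (ν := ν) (t + 1)
  calc _ ≤ P.weight φ ν (t + 1) / P.τ₀ * (2 * (P.L * P.B) / P.sigma φ ν (t + 1)) := by
        gcongr
    _ = 2 * (P.L * P.B * P.weight φ ν (t + 1)) / P.sigma φ ν (t + 1) / P.τ₀ := by ring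
    _ ≤ 2 * (P.sigma φ ν (t + 1) * (P.τ₀ / 4)) / P.sigma φ ν (t + 1) / P.τ₀ := by
        have := hw.trans (mul_le_mul_of_nonneg_left hsqrt hσt.le)
        gcongr
    _ = 1 / 2 := by field_simp; norm_num

/-- The confidence set contains the true parameter when both potentials are small. -/
lemma mem_confSet (hd : 0 < P.d) (hlam : 0 < P.lam) (hσ : 0 < P.sigmaMin) (hτ₀ : 0 < P.τ₀)
    (hδ : 0 < P.δ) (hδ1 : P.δ < 1) (hlog : 0 < Real.log (2 * (P.T : ℝ) ^ 2 / P.δ))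
    (hlogδ : Real.log P.δ⁻¹ ≤ Real.log (2 * (P.T : ℝ) ^ 2 / P.δ))
    (hκ : 2 * P.kappa ≤ P.τ₀ ^ 2 * Real.log (2 * (P.T : ℝ) ^ 2 / P.δ))
    (hdκ : (P.d : ℝ) ≤ 2 * P.kappa) (hL : 0 ≤ P.L) (hB : 0 ≤ P.B)
    (hφ : ∀ t < P.T, ‖φ (t + 1)‖ ≤ P.L) {D : ℕ → Set (Vec P.d)} {y : ℕ → ℝ}
    {θ : ℕ → Vec P.d} {θs : Vec P.d} (hθs : ‖θs‖ ≤ P.B)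
    (hy : ∀ s < P.T, y (s + 1) = ⟪φ (s + 1), θs⟫ + ε (s + 1))
    (hrun : P.IsAdaOFULRun D φ ν y θ) (hout : P.outlierPotential φ ν ε P.T < P.δ⁻¹)
    (hnoise : ∀ t < P.T,
      P.noisePotential φ ν ε (t + 1) < (P.δ * (1 / ((t : ℝ) + 1) ^ 2))⁻¹)
    {t : ℕ} (ht : t ≤ P.T) : θs ∈ P.confSet φ ν θ t := by
  refine ⟨hθs, ?_⟩
  cases t with
  | zero =>
    rw [hrun.init, sub_zero, beta]
    refine abs_le_of_sq_le_sq' ?_ (by positivity) |>.2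
    rw [matNorm_shape_sq hlam, mul_pow, Real.sq_sqrt hlam.le]
    simp
    gcongr
  | succ t =>
    obtain ⟨hx, hmin⟩ := hrun.estimator (t + 1) (by omega) ht
    have h1 := estimation_error_le (φ := φ) (ν := ν) (ε := ε) hlam hτ₀
      (fun s hs => hy s (by omega)) hθs hx hmin
      (fun s hs => leverage_mul_shift_le hd hlam hσ hτ₀ hlog hκ hdκ hL hB (hφ s (by omega)) hx hθs)
      (sum_outlier_le_of_outlierPotential_lt hd hlam hσ hτ₀ hφ hδ hlog hlogδ hκ hout ht)
    have h2 := noise_le_of_noisePotential_lt hd hlam hσ hτ₀ hφ ht (by positivity) (hnoise t ht)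
    have e : 2 * (P.δ * (1 / ((t : ℝ) + 1) ^ 2))⁻¹ = 2 * ((t + 1 : ℕ) : ℝ) ^ 2 / P.δ := by
      push_cast
      field_simp
    rw [e] at h2
    have hl := log_two_mul_sq_div_pos hδ hδ1 t.succ_pos
    have h3 : 0 ≤ Real.sqrt (P.kappa * Real.log (2 * ((t + 1 : ℕ) : ℝ) ^ 2 / P.δ)) :=
      Real.sqrt_nonneg _
    have h4 : 0 ≤ P.kappa / P.τ₀ := div_nonneg (kappa_nonneg hlam) hτ₀.le
    have h5 : 0 ≤ P.τ₀ * Real.log (2 * ((t + 1 : ℕ) : ℝ) ^ 2 / P.δ) := mul_nonneg hτ₀.le hl.le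
    have h6 : 0 ≤ Real.sqrt P.lam * P.B := by positivity
    -- Four times the noise bound has coefficients 6 and 4, with 4 on the ridge term; the radius
    -- provides 32, 32 and 5.
    rw [← matNorm_neg, neg_sub, beta]
    linarith

end AdaOFULParams

/-! ### Assembly of the regret bound. -/

theorem theorem2
    (P : AdaOFULParams) (hd : 0 < P.d) (hT : 0 < P.T)
    (hδ : 0 < P.δ) (hδ1 : P.δ < 1) (hlam : 0 < P.lam)
    (hL : 0 ≤ P.L) (hB : 0 ≤ P.B) (hτ₀ : 0 < P.τ₀)
    (hσ : P.sigmaMin = 1 / Real.sqrt (P.T : ℝ))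
    (hτ : max (Real.sqrt (2 * P.kappa)) (2 * Real.sqrt (P.d : ℝ) * (P.L * P.B)) ≤
      P.τ₀ * Real.sqrt (Real.log (2 * (P.T : ℝ) ^ 2 / P.δ)))
    {Ω : Type*} [mΩ : MeasurableSpace Ω] (μ : Measure Ω) [IsProbabilityMeasure μ]
    (ℱ : Filtration ℕ mΩ) (D : ℕ → Set (Vec P.d)) (θs : Vec P.d)
    (φ : ℕ → Ω → Vec P.d) (ν y ε : ℕ → Ω → ℝ) (θ : ℕ → Ω → Vec P.d)
    (hbandit : IsHeavyTailedBandit μ ℱ P.T P.L P.B D θs φ ν y ε)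
    (hrun : ∀ ω, P.IsAdaOFULRun D (fun t => φ t ω) (fun t => ν t ω) (fun t => y t ω)
      (fun t => θ t ω)) :
    ENNReal.ofReal (1 - 3 * P.δ) ≤
      μ {ω | regret P.T D θs (fun t => φ t ω) ≤
        2 * P.beta P.T *
          (Real.sqrt (2 * P.kappa) *
              Real.sqrt ((∑ t ∈ Finset.Icc 1 P.T, (ν t ω) ^ 2) + 1)
            + 2 * P.L * P.kappa / (P.c₀ ^ 2 * Real.sqrt P.lam)
            + 2 * P.L * P.B * P.kappa / Real.sqrt (P.c₁ * (P.d : ℝ)))} := by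
  have hT' : (0 : ℝ) < P.T := by exact_mod_cast hT
  have hσ0 : 0 < P.sigmaMin := by rw [hσ]; positivity
  have hlog := log_two_mul_sq_div_pos hδ hδ1 hT
  have hκ0 := AdaOFULParams.kappa_nonneg hlam
  have hc0 := AdaOFULParams.c₀_pos hlog
  have hc1 := AdaOFULParams.c₁_pos hlog
  have hβ : 0 ≤ P.beta P.T :=
    le_trans (by positivity) (AdaOFULParams.sqrt_lam_mul_le_beta hδ hδ1 hlam hB hτ₀ P.T)
  have hlogδ : Real.log P.δ⁻¹ ≤ Real.log (2 * (P.T : ℝ) ^ 2 / P.δ) := by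
    refine Real.log_le_log (inv_pos.2 hδ) ?_
    rw [inv_eq_one_div]
    have : (1 : ℝ) ≤ (P.T : ℝ) ^ 2 := one_le_pow₀ (by exact_mod_cast hT)
    gcongr
    linarith
  -- For a ratio at most 1 the bound holds surely. Above 1, `κ ≥ d log 2`, which supplies `d ≤ 2κ`.
  rcases le_or_gt ((P.T : ℝ) * P.L ^ 2 / ((P.d : ℝ) * P.lam * P.sigmaMin ^ 2)) 1 with hr | hr
  · refine le_trans (ENNReal.ofReal_le_one.2 (by linarith)) ?_
    rw [← measure_univ (μ := μ)]
    refine measure_mono fun ω _ => ?_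
    refine (AdaOFULParams.regret_le_of_ratio_le_one hd hT hδ hδ1 hlam hL hB hτ₀ hσ hr
      (fun t ht => hbandit.mem t ht ω) hbandit.mean_bound).trans ?_
    refine mul_le_mul_of_nonneg_left ?_ (by positivity)
    have h1 : 1 ≤ Real.sqrt ((∑ t ∈ Finset.Icc 1 P.T, (ν t ω) ^ 2) + 1) :=
      Real.one_le_sqrt.2 (le_add_of_nonneg_left (Finset.sum_nonneg fun _ _ => sq_nonneg _))
    have h2 := le_mul_of_one_le_right (Real.sqrt_nonneg (2 * P.kappa)) h1
    have h3 : 0 ≤ 2 * P.L * P.kappa / (P.c₀ ^ 2 * Real.sqrt P.lam) := by positivity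
    have h4 : 0 ≤ 2 * P.L * P.B * P.kappa / Real.sqrt (P.c₁ * (P.d : ℝ)) := by positivity
    linarith
  have hκ : 2 * P.kappa ≤ P.τ₀ ^ 2 * Real.log (2 * (P.T : ℝ) ^ 2 / P.δ) := by
    have h1 := (le_max_left _ _).trans hτ
    have h2 := pow_le_pow_left₀ (Real.sqrt_nonneg _) h1 2
    rwa [mul_pow, Real.sq_sqrt hlog.le, Real.sq_sqrt (by positivity)] at h2
  have hdκ : (P.d : ℝ) ≤ 2 * P.kappa := by
    have hl : 1 / 2 ≤ Real.log (1 + (P.T : ℝ) * P.L ^ 2 /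
        ((P.d : ℝ) * P.lam * P.sigmaMin ^ 2)) := by
      refine le_trans (by linarith [Real.log_two_gt_d9]) (Real.log_le_log two_pos ?_)
      linarith
    have hd' : (0 : ℝ) < P.d := by exact_mod_cast hd
    rw [AdaOFULParams.kappa]
    nlinarith
  have hc01 : P.c₀ ≤ 1 := by
    have h1 : P.c₀ ^ 2 ≤ 1 := by
      have h2 : 1 / 2 ≤ Real.log (2 * (P.T : ℝ) ^ 2 / P.δ) := by
        refine le_trans (by linarith [Real.log_two_gt_d9]) (Real.log_le_log two_pos ?_)
        rw [le_div_iff₀ hδ]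
        have : (1 : ℝ) ≤ (P.T : ℝ) ^ 2 := one_le_pow₀ (by exact_mod_cast hT)
        linarith
      rw [AdaOFULParams.c₀_sq hlog, div_le_one (by positivity)]
      linarith
    exact (sq_le_one_iff₀ hc0.le).1 h1
  set good := {ω | regret P.T D θs (fun t => φ t ω) ≤
        2 * P.beta P.T *
          (Real.sqrt (2 * P.kappa) *
              Real.sqrt ((∑ t ∈ Finset.Icc 1 P.T, (ν t ω) ^ 2) + 1)
            + 2 * P.L * P.kappa / (P.c₀ ^ 2 * Real.sqrt P.lam)
            + 2 * P.L * P.B * P.kappa / Real.sqrt (P.c₁ * (P.d : ℝ)))} with hgood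
  set outlier := {ω | P.δ⁻¹ ≤
    P.outlierPotential (fun s => φ s ω) (fun s => ν s ω) (fun s => ε s ω) P.T} with houtlier
  set noisy : ℕ → Set Ω := fun t => {ω | (P.δ * (1 / ((t : ℝ) + 1) ^ 2))⁻¹ ≤
    P.noisePotential (fun s => φ s ω) (fun s => ν s ω) (fun s => ε s ω) (t + 1)} with hnoisy
  -- Working with a cover of the whole space and subadditivity avoids proving that the good event is
  -- measurable.
  have hcover : (Set.univ : Set Ω) ⊆ good ∪ (outlier ∪ ⋃ t ∈ Finset.range P.T, noisy t) := by
    intro ω _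
    by_cases hbad : ω ∈ outlier ∪ ⋃ t ∈ Finset.range P.T, noisy t
    · exact Or.inr hbad
    · refine Or.inl ?_
      simp only [houtlier, hnoisy, Set.mem_union, Set.mem_iUnion, Set.mem_ofPred_eq, not_or,
        not_exists, not_le, Finset.mem_range] at hbad
      have hmem : ∀ t < P.T, θs ∈ P.confSet (fun s => φ s ω) (fun s => ν s ω)
          (fun s => θ s ω) t := fun t ht =>
        AdaOFULParams.mem_confSet (P := P) (φ := fun s => φ s ω) (ν := fun s => ν s ω)
          (ε := fun s => ε s ω) hd hlam hσ0 hτ₀ hδ hδ1 hlog hlogδ hκ hdκ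
          hL hB (fun s hs => hbandit.norm_feature s hs ω) hbandit.norm_param
          (fun s hs => hbandit.reward s hs ω) (hrun ω) hbad.1 hbad.2 ht.le
      have hreg := AdaOFULParams.regret_le_of_mem_confSet (P := P) hδ hδ1 hlam hB hτ₀ hσ0 (hrun ω) hmem
      have hsum := AdaOFULParams.sum_weight_mul_sigma_le (P := P) (φ := fun s => φ s ω)
        (ν := fun s => ν s ω) hd hT hlam hσ hc0 hc01 hc1 hL hB
        fun s hs => hbandit.norm_feature s hs ω
      exact hreg.trans (mul_le_mul_of_nonneg_left hsum (mul_nonneg zero_le_two hβ))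
  have houtP : μ outlier ≤ ENNReal.ofReal P.δ :=
    measure_inv_le_of_integral_le_one
      (AdaOFULParams.integrable_outlierPotential hbandit hlam hσ0 hc0 le_rfl)
      (fun ω => AdaOFULParams.outlierPotential_nonneg _)
      (AdaOFULParams.integral_outlierPotential_le_one hbandit hlam hσ0 hc0 hτ₀ le_rfl) hδ
  have hnoisyP : μ (⋃ t ∈ Finset.range P.T, noisy t) ≤ ENNReal.ofReal (2 * P.δ) := by
    calc μ (⋃ t ∈ Finset.range P.T, noisy t) ≤ ∑ t ∈ Finset.range P.T, μ (noisy t) :=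
          measure_biUnion_finset_le _ _
      _ ≤ ∑ t ∈ Finset.range P.T, ENNReal.ofReal (P.δ * (1 / ((t : ℝ) + 1) ^ 2)) :=
          Finset.sum_le_sum fun t ht => measure_inv_le_of_integral_le_one
            (AdaOFULParams.integrable_noisePotential hbandit hlam hτ₀ (Finset.mem_range.1 ht))
            (fun ω => AdaOFULParams.noisePotential_nonneg _)
            (AdaOFULParams.integral_noisePotential_le_one hbandit hlam hσ0 hτ₀
              (Finset.mem_range.1 ht)) (by positivity)
      _ = ENNReal.ofReal (∑ t ∈ Finset.range P.T, P.δ * (1 / ((t : ℝ) + 1) ^ 2)) :=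
          (ENNReal.ofReal_sum_of_nonneg fun t _ => by positivity).symm
      _ ≤ ENNReal.ofReal (2 * P.δ) := by
          refine ENNReal.ofReal_le_ofReal ?_
          rw [← Finset.mul_sum, mul_comm]
          exact mul_le_mul_of_nonneg_right (sum_inv_succ_sq_le _) hδ.le
  have hone : (1 : ENNReal) ≤ μ good + ENNReal.ofReal (3 * P.δ) := by
    calc (1 : ENNReal) = μ Set.univ := measure_univ.symm
      _ ≤ μ good + (μ outlier + μ (⋃ t ∈ Finset.range P.T, noisy t)) :=
          (measure_mono hcover).trans ((measure_union_le _ _).trans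
            (add_le_add le_rfl (measure_union_le _ _)))
      _ ≤ μ good + (ENNReal.ofReal P.δ + ENNReal.ofReal (2 * P.δ)) := by gcongr
      _ = μ good + ENNReal.ofReal (3 * P.δ) := by
          rw [← ENNReal.ofReal_add hδ.le (by positivity)]
          ring_nf
  rw [ENNReal.ofReal_sub _ (by positivity), ENNReal.ofReal_one]
  exact tsub_le_iff_right.2 hone
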